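/- Consider a discounted constrained Markov decision process with measurable state space $\mathcal S$ and action space $\mathcal A$, transition kernel $P(s'\mid s,a)$, initial distribution $\rho$, discount factor $\gamma\in(0,1)$, reward $r_0:\mathcal S\times\mathcal A\to[0,1]$ and utilities $r_i:\mathcal S\times\mathcal A\to[-1,1]$, $i=1,\dots,m$. Let $\{\pi_\theta:\theta\in\mathbb R^d\}$ be a family of stationary stochastic policies with densities $\pi_\theta(a\mid s)$ with respect to a reference measure on $\mathcal A$, and let $$V_i^\theta(\rho):=\mathbb E\Big[\sum_{t=0}^\infty\gamma^t r_i(s_t,a_t)\Big],\qquad s_0\sim\rho,\ a_t\sim\pi_\theta(\cdot\mid s_t),\ s_{t+1}\sim P(\cdot\mid s_t,a_t).$$ Given $n\ge 1$ independent trajectories $(s_t^j,a_t^j)_{t=0}^{H-1}$, $j=1,\dots,n$, sampled under $\pi_\theta$ and truncated at horizon $H\ge 0$, put $$\hat V_i^\theta(\rho):=\frac1n\sum_{j=1}^n\sum_{t=0}^{H-1}\gamma^t r_i(s_t^j,a_t^j),\qquad \hat\nabla_\theta V_i^\theta(\rho):=\frac1n\sum_{j=1}^n\sum_{t=0}^{H-1}\sum_{t'=0}^{t}\gamma^t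 r_i(s_t^j,a_t^j)\,\nabla_\theta\log\pi_\theta(a_{t'}^j\mid s_{t'}^j).$$ Let $U\subseteq\mathbb R^d$ be open (for example $U=\mathbb R^d$, or an open set containing the feasible set $\Theta=\{\theta: V_i^\theta(\rho)\ge0,\ i=1,\dots,m\}$) and let $M_g,M_h>0$ be such that, for all $\theta\in U$ and all $(s,a)$, $\pi_\theta(a\mid s)>0$, $\theta\mapsto\log\pi_\theta(a\mid s)$ is twice differentiable, $\|\nabla_\theta\log\pi_\theta(a\mid s)\|\le M_g$ and $\|\nabla_\theta^2\log\pi_\theta(a\mid s)\|\le M_h$. (Norms are the Euclidean norm of vectors and the operator norm of matrices.) Then for every $i\in\{0,\dots,m\}$: 1. $\theta\mapsto V_i^\theta(\rho)$ is differentiable on $U$, and on every set $X\subseteq\mathbb R^d$ whose convex hull is contained in $U$ (in particular on $X=\Theta$ if the convex hull of $\Theta$ is contained in $U$) it is $L$-Lipschitz continuous and $M$-smooth with $L:=\frac{M_g}{(1-\gamma)^2}$ and $M:=\frac{M_g^2+M_h}{(1-\gamma)^2}$; here $f$ is $M$-smooth on $X$ if $f(x)\le f(y)+\langle\nabla f(y),x-y\rangle+\frac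 M2\|x-y\|^2$ for all $x,y\in X$. 2. For every $\theta\in U$, $n\ge1$, $H\ge0$, both estimators are integrable and, with $b^0(H):=\frac{\gamma^H}{1-\gamma}$ and $b^1(H):=\frac{M_g\gamma^H}{1-\gamma}\sqrt{\frac1{1-\gamma}+H}$, $$\big|V_i^\theta(\rho)-\mathbb E[\hat V_i^\theta(\rho)]\big|\le b^0(H),\qquad \big\|\nabla_\theta V_i^\theta(\rho)-\mathbb E[\hat\nabla_\theta V_i^\theta(\rho)]\big\|\le b^1(H).$$ 3. Let $\sigma^0(n):=\frac{\sqrt2}{\sqrt n(1-\gamma)}$ and $\sigma^1(n):=\frac{2\sqrt2M_g}{\sqrt n(1-\gamma)^{3/2}}$. For every $\theta\in U$, $n\ge1$, $H\ge0$ and $\delta\in(0,1)$, $$\mathbb P\Big(\big|\hat V_i^\theta(\rho)-\mathbb E[\hat V_i^\theta(\rho)]\big|\le\sigma^0(n)\sqrt{\ln\tfrac2\delta}\Big)\ge1-\delta,$$ and if moreover $n\ge8\ln\frac{e^{1/4}}{\delta}$, then $$\mathbb P\Big(\big\|\hat\nabla_\theta V_i^\theta(\rho)-\mathbb E[\hat\nabla_\theta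 V_i^\theta(\rho)]\big\|\le\sigma^1(n)\sqrt{\ln\tfrac{e^{1/4}}\delta}\Big)\ge1-\delta.$$ -/

import Mathlib

open MeasureTheory ProbabilityTheory
open scoped ENNReal RealInnerProductSpace

/-- A discounted constrained Markov decision process with `m` constraints on measurable state and
action spaces: `r 0` is the reward, `r 1, …, r m` are the utilities. -/
structure CMDP (S A : Type*) [MeasurableSpace S] [MeasurableSpace A] (m : ℕ) where
  /-- transition kernel `P(s' | s, a)` -/
  P : Kernel (S × A) S
  markov : IsMarkovKernel P
  /-- initial state distribution -/
  ρ : Measure S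
  prob : IsProbabilityMeasure ρ
  /-- reward (index `0`) and utility functions -/
  r : Fin (m + 1) → S × A → ℝ
  measurable_r : ∀ i, Measurable (r i)
  reward_mem : ∀ x, r 0 x ∈ Set.Icc (0 : ℝ) 1
  utility_mem : ∀ i x, r i x ∈ Set.Icc (-1 : ℝ) 1
  /-- discount factor -/
  γ : ℝ
  γ_pos : 0 < γ
  γ_lt_one : γ < 1

/-- A family of stationary stochastic policies `π_θ(a | s)`, `θ ∈ ℝ^d`, given by probability
densities with respect to a reference measure `ν` on the action space (counting measure for
discrete actions, Lebesgue measure for continuous actions). -/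
structure PolicyFamily (S A : Type*) [MeasurableSpace S] [MeasurableSpace A] (d : ℕ)
    (ν : Measure A) where
  /-- `dens θ s a = π_θ(a | s)` -/
  dens : EuclideanSpace ℝ (Fin d) → S → A → ℝ
  measurable_dens : ∀ θ, Measurable (Function.uncurry (dens θ))
  nonneg : ∀ θ s a, 0 ≤ dens θ s a
  lintegral_eq_one : ∀ θ s, ∫⁻ a, ENNReal.ofReal (dens θ s a) ∂ν = 1

attribute [instance] CMDP.markov CMDP.prob

section

variable {S A : Type*} [MeasurableSpace S] [MeasurableSpace A] {m d : ℕ} {ν : Measure A} [SFinite ν]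

namespace PolicyFamily

/-- The policy `π_θ` as a kernel from states to actions. -/
noncomputable def kernel (π : PolicyFamily S A d ν) (θ : EuclideanSpace ℝ (Fin d)) : Kernel S A :=
  Kernel.withDensity (Kernel.const S ν) (fun s a => ENNReal.ofReal (π.dens θ s a))

instance isMarkovKernel_kernel (π : PolicyFamily S A d ν) (θ : EuclideanSpace ℝ (Fin d)) :
    IsMarkovKernel (π.kernel θ) := by
  refine ⟨fun s => ⟨?_⟩⟩
  have h : Measurable (Function.uncurry fun s a => ENNReal.ofReal (π.dens θ s a)) :=
    (π.measurable_dens θ).ennreal_ofReal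
  rw [kernel, Kernel.withDensity_apply' _ h]
  simpa using π.lintegral_eq_one θ s

/-- The score `∇_θ log π_θ(a | s)`. -/
noncomputable def score (π : PolicyFamily S A d ν) (θ : EuclideanSpace ℝ (Fin d)) (s : S) (a : A) :
    EuclideanSpace ℝ (Fin d) :=
  gradient (fun θ' => Real.log (π.dens θ' s a)) θ

/-- The Hessian `∇²_θ log π_θ(a | s)`, as a linear operator (so that its norm is the operator
norm). -/
noncomputable def hessian (π : PolicyFamily S A d ν) (θ : EuclideanSpace ℝ (Fin d)) (s : S)
    (a : A) : EuclideanSpace ℝ (Fin d) →L[ℝ] EuclideanSpace ℝ (Fin d) :=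
  fderiv ℝ (fun θ' => π.score θ' s a) θ

/-- On the parameter set `U`, the function `θ ↦ log π_θ(a | s)` is well defined and twice
differentiable, with gradient bounded by `Mg` and Hessian bounded by `Mh`, for all `s`, `a`. -/
structure BoundedScore (π : PolicyFamily S A d ν) (U : Set (EuclideanSpace ℝ (Fin d)))
    (Mg Mh : ℝ) : Prop where
  pos : ∀ θ ∈ U, ∀ s a, 0 < π.dens θ s a
  differentiableAt_log : ∀ θ ∈ U, ∀ s a,
    DifferentiableAt ℝ (fun θ' => Real.log (π.dens θ' s a)) θ
  differentiableAt_score : ∀ θ ∈ U, ∀ s a, DifferentiableAt ℝ (fun θ' => π.score θ' s a) θ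
  norm_score_le : ∀ θ ∈ U, ∀ s a, ‖π.score θ s a‖ ≤ Mg
  norm_hessian_le : ∀ θ ∈ U, ∀ s a, ‖π.hessian θ s a‖ ≤ Mh

end PolicyFamily

namespace CMDP

/-- One step of the state-action chain: from `(s, a)`, draw `s' ∼ P(· | s, a)`, then
`a' ∼ π_θ(· | s')`. -/
noncomputable def stepKernel (M : CMDP S A m) (π : PolicyFamily S A d ν)
    (θ : EuclideanSpace ℝ (Fin d)) : Kernel (S × A) (S × A) :=
  M.P ⊗ₖ Kernel.prodMkLeft (S × A) (π.kernel θ)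

instance isMarkovKernel_stepKernel (M : CMDP S A m) (π : PolicyFamily S A d ν)
    (θ : EuclideanSpace ℝ (Fin d)) : IsMarkovKernel (M.stepKernel π θ) := by
  unfold stepKernel; infer_instance

/-- The law of the infinite trajectory `(s_0, a_0, s_1, a_1, …)` with `s_0 ∼ ρ`,
`a_t ∼ π_θ(· | s_t)`, `s_{t+1} ∼ P(· | s_t, a_t)`. -/
noncomputable def trajLaw (M : CMDP S A m) (π : PolicyFamily S A d ν)
    (θ : EuclideanSpace ℝ (Fin d)) : Measure (ℕ → S × A) :=
  Kernel.trajMeasure (X := fun _ => S × A) (M.ρ ⊗ₘ π.kernel θ)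
    (fun t => (M.stepKernel π θ).comap
      (fun x : (i : Finset.Iic t) → S × A => x ⟨t, Finset.mem_Iic.2 le_rfl⟩)
      (measurable_pi_apply _))

/-- The law of the trajectory truncated at horizon `H`, i.e. of `(s_t, a_t)_{t < H}`. -/
noncomputable def truncLaw (M : CMDP S A m) (π : PolicyFamily S A d ν)
    (θ : EuclideanSpace ℝ (Fin d)) (H : ℕ) : Measure (Fin H → S × A) :=
  (M.trajLaw π θ).map (fun τ (t : Fin H) => τ t)

/-- The value `V_i^θ(ρ) = 𝔼[∑_{t ≥ 0} γ^t r_i(s_t, a_t)]`. -/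
noncomputable def value (M : CMDP S A m) (π : PolicyFamily S A d ν) (i : Fin (m + 1))
    (θ : EuclideanSpace ℝ (Fin d)) : ℝ :=
  ∫ τ, ∑' t : ℕ, M.γ ^ t * M.r i (τ t) ∂(M.trajLaw π θ)

/-- The Monte Carlo estimator of `V_i^θ(ρ)` from `n` trajectories of horizon `H`. -/
noncomputable def valueEst (M : CMDP S A m) (i : Fin (m + 1)) {n H : ℕ}
    (τ : Fin n → Fin H → S × A) : ℝ :=
  (1 / (n : ℝ)) * ∑ j : Fin n, ∑ t : Fin H, M.γ ^ (t : ℕ) * M.r i (τ j t)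

/-- The GPOMDP estimator of `∇_θ V_i^θ(ρ)` from `n` trajectories of horizon `H`. -/
noncomputable def gradEst (M : CMDP S A m) (π : PolicyFamily S A d ν) (i : Fin (m + 1))
    (θ : EuclideanSpace ℝ (Fin d)) {n H : ℕ} (τ : Fin n → Fin H → S × A) :
    EuclideanSpace ℝ (Fin d) :=
  (1 / (n : ℝ)) • ∑ j : Fin n, ∑ t : Fin H, ∑ t' ∈ Finset.Iic t,
    (M.γ ^ (t : ℕ) * M.r i (τ j t)) • π.score θ (τ j t').1 (τ j t').2

end CMDP

end

/-- `f` is `L`-Lipschitz continuous on `X`. -/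
def LipschitzContOn {d : ℕ} (f : EuclideanSpace ℝ (Fin d) → ℝ) (L : ℝ)
    (X : Set (EuclideanSpace ℝ (Fin d))) : Prop :=
  ∀ x ∈ X, ∀ y ∈ X, |f x - f y| ≤ L * ‖x - y‖

/-- `f` is `M`-smooth on `X`: `f x ≤ f y + ⟨∇f(y), x - y⟩ + (M / 2) ‖x - y‖²` on `X`. -/
def MSmoothOn {d : ℕ} (f : EuclideanSpace ℝ (Fin d) → ℝ) (M : ℝ)
    (X : Set (EuclideanSpace ℝ (Fin d))) : Prop :=
  ∀ x ∈ X, ∀ y ∈ X, f x ≤ f y + ⟪gradient f y, x - y⟫ + M / 2 * ‖x - y‖ ^ 2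

/-- Bias bound of the value estimator. -/
noncomputable def biasValue (γ : ℝ) (H : ℕ) : ℝ := γ ^ H / (1 - γ)

/-- Bias bound of the gradient estimator. -/
noncomputable def biasGrad (γ Mg : ℝ) (H : ℕ) : ℝ :=
  Mg * γ ^ H / (1 - γ) * √(1 / (1 - γ) + H)

/-- Sub-Gaussian scale of the value estimator. -/
noncomputable def scaleValue (γ : ℝ) (n : ℕ) : ℝ := √2 / (√n * (1 - γ))

/-- Sub-Gaussian scale of the gradient estimator. -/
noncomputable def scaleGrad (γ Mg : ℝ) (n : ℕ) : ℝ :=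
  2 * √2 * Mg / (√n * (1 - γ) ^ (3 / 2 : ℝ))

/-!
A change of measure to a fixed `θ` makes `𝔼[r(s_t, a_t)]` an integral over trajectories in which
the parameter enters only through the likelihood ratio of the actions. Differentiating under the
integral sign gives the gradient `𝔼[r Z_t]`, with `Z_t = ∑_{k ≤ t} ∇ log π_θ(a_k | s_k)`, and the
Hessian `𝔼[r (Z_t Z_tᵀ + ∇ Z_t)]`.

Each score is bounded by `M_g` and centred given the past, so `Z_t` is a martingale with
orthogonal increments: `𝔼⟪u, Z_t⟫² ≤ (t + 1) M_g² ‖u‖²`. Hence the gradient is at most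
`M_g √(t + 1)` and the Hessian at most `(M_g² + M_h)(t + 1)`, and `∑ γ ^ t (t + 1) = 1 / (1 - γ)²`
gives `L` and `M`. The bias of the gradient estimator is at most `M_g ∑_{t ≥ H} γ ^ t √(t + 1)`,
which Jensen's inequality for the geometric law bounds by `b¹(H)`.

For the tails, `𝔼 cosh ‖z + Y‖ ≤ cosh ‖z‖ cosh M_g` for every centred `Y` with `‖Y‖ ≤ M_g`, so
`Z_t` has the hyperbolic-cosine moments of a Gaussian of scale `M_g √(t + 1)`, whatever the
dimension, and by the same Jensen bound the gradient estimate of one trajectory has those of scale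
`M_g / (1 - γ) ^ (3 / 2)`. Independent centred vectors again allow `cosh` moments to be multiplied;
Chernoff's bound handles the large deviations of their mean and Chebyshev's inequality the
moderate ones, where the constant in front of the exponential would be lost.
-/

section Gradients

variable {E : Type*} [NormedAddCommGroup E] [InnerProductSpace ℝ E]

section

variable [CompleteSpace E]

lemma abs_sub_le_of_hasGradientAt {f : E → ℝ} {G : E → E} {s : Set E} {B : ℝ} {x y : E}
    (hs : Convex ℝ s) (hG : ∀ z ∈ s, HasGradientAt f (G z) z) (hB : ∀ z ∈ s, ‖G z‖ ≤ B)
    (hx : x ∈ s) (hy : y ∈ s) : |f x - f y| ≤ B * ‖x - y‖ :=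
  hs.norm_image_sub_le_of_norm_hasFDerivWithin_le (𝕜 := ℝ)
    (fun z hz => (hG z hz).hasFDerivAt.hasFDerivWithinAt)
    (fun z hz => by simpa using hB z hz) hy hx

lemma hasGradientAt_finset_sum {ι : Type*} {s : Finset ι} {f : ι → E → ℝ} {G : ι → E} {θ : E}
    (h : ∀ i ∈ s, HasGradientAt (f i) (G i) θ) :
    HasGradientAt (fun η => ∑ i ∈ s, f i η) (∑ i ∈ s, G i) θ := by
  rw [hasGradientAt_iff_hasFDerivAt, map_sum]
  exact HasFDerivAt.fun_sum fun i hi => (h i hi).hasFDerivAt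

lemma hasGradientAt_exp_mul {l g : E → ℝ} {Gl Gg θ : E} (hl : HasGradientAt l Gl θ)
    (hg : HasGradientAt g Gg θ) :
    HasGradientAt (fun η => Real.exp (l η) * g η) (Real.exp (l θ) • (g θ • Gl + Gg)) θ := by
  refine (hl.hasFDerivAt.exp.mul hg.hasFDerivAt).congr_fderiv ?_
  ext v
  simp only [add_apply, smul_apply, InnerProductSpace.toDual_apply_apply, inner_add_left,
    real_inner_smul_left, smul_eq_mul]
  ring

end

variable {T : Type*} [MeasurableSpace T]

lemma measurable_of_hasDerivAt {f : ℝ → T → ℝ} {f' : T → ℝ} {a : ℝ}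
    (hf : ∀ᶠ u in nhds a, Measurable (f u)) (hf' : ∀ x, HasDerivAt (fun u => f u x) (f' x) a) :
    Measurable f' := by
  let c : ℕ → ℝ := fun n => a + 1 / ((n : ℝ) + 1)
  have hc : Filter.Tendsto c Filter.atTop (nhds a) := by
    simpa only [add_zero] using tendsto_one_div_add_atTop_nhds_zero_nat.const_add a
  have hc' : Filter.Tendsto c Filter.atTop (nhdsWithin a {a}ᶜ) :=
    tendsto_nhdsWithin_iff.2 ⟨hc, Filter.Eventually.of_forall fun n => by
      have : (0 : ℝ) < 1 / ((n : ℝ) + 1) := by positivity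
      simpa [c] using this.ne'⟩
  obtain ⟨N, hN⟩ := Filter.eventually_atTop.1 (hc.eventually hf)
  refine measurable_of_tendsto_metrizable (f := fun n x => slope (fun u => f u x) a (c (n + N)))
    (fun n => ?_) (tendsto_pi_nhds.2 fun x =>
      (hf' x).tendsto_slope.comp (hc'.comp (Filter.tendsto_add_atTop_nat N)))
  simp only [slope_def_field]
  exact ((hN _ (Nat.le_add_left N n)).sub hf.self_of_nhds).div_const _

variable [FiniteDimensional ℝ E] [MeasurableSpace E] [BorelSpace E]

lemma measurable_of_hasGradientAt {f : E → T → ℝ} {G : T → E} {θ : E}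
    (hf : ∀ᶠ η in nhds θ, Measurable (f η))
    (hG : ∀ x, HasGradientAt (fun η => f η x) (G x) θ) : Measurable G := by
  have hinner : ∀ v : E, Measurable fun x => ⟪v, G x⟫ := fun v => by
    have hline : HasDerivAt (fun u : ℝ => θ + u • v) v 0 := by
      simpa using ((hasDerivAt_id (0 : ℝ)).smul_const v).const_add θ
    refine measurable_of_hasDerivAt (f := fun u x => f (θ + u • v) x) (a := 0) ?_ fun x => ?_
    · have := hline.continuousAt.tendsto
      simp only [zero_smul, add_zero] at this
      exact this.eventually hf
    · have hG' : HasFDerivAt (fun η => f η x) (InnerProductSpace.toDual ℝ E (G x))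
          (θ + (0 : ℝ) • v) := by simpa using (hG x).hasFDerivAt
      simpa [Function.comp_def, real_inner_comm] using hG'.comp_hasDerivAt 0 hline
  let e := stdOrthonormalBasis ℝ E
  have hsum : G = fun x => ∑ i, ⟪e i, G x⟫ • e i := funext fun x => (e.sum_repr' (G x)).symm
  rw [hsum]
  exact Finset.measurable_fun_sum _ fun i _ => (hinner (e i)).smul_const (e i)

lemma hasGradientAt_integral_of_norm_le {μ : Measure T} [IsFiniteMeasure μ] {f : E → T → ℝ}
    {G : E → T → E} {θ : E} {s : Set E} {B : ℝ} (hs : s ∈ nhds θ) (hf : ∀ η ∈ s, Measurable (f η))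
    (hint : Integrable (f θ) μ) (hG : ∀ η ∈ s, ∀ x, HasGradientAt (fun η => f η x) (G η x) η)
    (hB : ∀ η ∈ s, ∀ x, ‖G η x‖ ≤ B) :
    HasGradientAt (fun η => ∫ x, f η x ∂μ) (∫ x, G θ x ∂μ) θ := by
  have hθ : θ ∈ s := mem_of_mem_nhds hs
  have hmeas : Measurable (G θ) :=
    measurable_of_hasGradientAt (Filter.eventually_of_mem hs hf) (hG θ hθ)
  have hGint : Integrable (G θ) μ :=
    .of_bound hmeas.aestronglyMeasurable B (.of_forall (hB θ hθ))
  have hderiv := hasFDerivAt_integral_of_dominated_of_fderiv_le (𝕜 := ℝ) (μ := μ)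
    (F' := fun η x => InnerProductSpace.toDual ℝ E (G η x)) (bound := fun _ => B) hs
    (Filter.eventually_of_mem hs fun η hη => (hf η hη).aestronglyMeasurable) hint
    ((InnerProductSpace.toDual ℝ E).continuous.comp_aestronglyMeasurable
      hmeas.aestronglyMeasurable)
    (.of_forall fun x η hη => by simpa using hB η hη x) (integrable_const B)
    (.of_forall fun x η hη => (hG η hη x).hasFDerivAt)
  refine hderiv.congr_fderiv (ContinuousLinearMap.ext fun v => ?_)
  rw [ContinuousLinearMap.integral_apply ((LinearIsometryEquiv.integrable_comp_iff _).2 hGint),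
    InnerProductSpace.toDual_apply_apply, real_inner_comm, ← integral_inner hGint]
  simp only [InnerProductSpace.toDual_apply_apply, real_inner_comm]

lemma hasGradientAt_integral_exp_sub_mul {μ : Measure T} [IsFiniteMeasure μ] {l g : E → T → ℝ}
    {S G : E → T → E} {θ : E} {U : Set E} {B C C' : ℝ} (hU : IsOpen U) (hθ : θ ∈ U)
    (hl_meas : ∀ η ∈ U, Measurable (l η)) (hg_meas : ∀ η ∈ U, Measurable (g η))
    (hl : ∀ η ∈ U, ∀ x, HasGradientAt (fun η => l η x) (S η x) η)
    (hg : ∀ η ∈ U, ∀ x, HasGradientAt (fun η => g η x) (G η x) η)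
    (hS_le : ∀ η ∈ U, ∀ x, ‖S η x‖ ≤ B) (hg_le : ∀ η ∈ U, ∀ x, |g η x| ≤ C)
    (hG_le : ∀ η ∈ U, ∀ x, ‖G η x‖ ≤ C') :
    HasGradientAt (fun η => ∫ x, Real.exp (l η x - l θ x) * g η x ∂μ)
      (∫ x, (g θ x • S θ x + G θ x) ∂μ) θ := by
  obtain ⟨ε, hε, hball⟩ := Metric.isOpen_iff.1 hU θ hθ
  have hderiv := hasGradientAt_integral_of_norm_le (μ := μ) (θ := θ)
    (f := fun η x => Real.exp (l η x - l θ x) * g η x)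
    (G := fun η x => Real.exp (l η x - l θ x) • (g η x • S η x + G η x))
    (B := Real.exp (B * ε) * (C * B + C')) (Metric.ball_mem_nhds θ hε)
    (fun η hη => (((hl_meas η (hball hη)).sub (hl_meas θ hθ)).exp).mul (hg_meas η (hball hη)))
    (.of_bound ((((hl_meas θ hθ).sub (hl_meas θ hθ)).exp).mul
      (hg_meas θ hθ)).aestronglyMeasurable C (.of_forall fun x => by simpa using hg_le θ hθ x))
    (fun η hη x => hasGradientAt_exp_mul
      (hasGradientAt_iff_hasFDerivAt.2 ((hl η (hball hη) x).hasFDerivAt.sub_const (l θ x)))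
      (hg η (hball hη) x)) ?_
  · simpa using hderiv
  intro η hη x
  have hB : 0 ≤ B := (norm_nonneg _).trans (hS_le θ hθ x)
  have hC : 0 ≤ C := (abs_nonneg _).trans (hg_le θ hθ x)
  have hlip : l η x - l θ x ≤ B * ε := calc
    l η x - l θ x ≤ |l η x - l θ x| := le_abs_self _
    _ ≤ B * ‖η - θ‖ := abs_sub_le_of_hasGradientAt (convex_ball θ ε)
        (fun z hz => hl z (hball hz) x) (fun z hz => hS_le z (hball hz) x) hη
        (Metric.mem_ball_self hε)
    _ ≤ B * ε := by gcongr; exact (mem_ball_iff_norm.1 hη).le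
  rw [norm_smul, Real.norm_eq_abs, Real.abs_exp]
  gcongr
  calc ‖g η x • S η x + G η x‖ ≤ |g η x| * ‖S η x‖ + ‖G η x‖ := by
        simpa [norm_smul] using norm_add_le (g η x • S η x) (G η x)
    _ ≤ C * B + C' := by
        gcongr
        exacts [hg_le η (hball hη) x, hS_le η (hball hη) x, hG_le η (hball hη) x]

end Gradients

section HilbertCalculus

variable {E : Type*} [NormedAddCommGroup E] [InnerProductSpace ℝ E] [CompleteSpace E]

lemma hasGradientAt_const_inner {F : E → E} {F' : E →L[ℝ] E} {θ : E} (hF : HasFDerivAt F F' θ)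
    (u : E) : HasGradientAt (fun η => ⟪u, F η⟫) (ContinuousLinearMap.adjoint F' u) θ := by
  refine ((innerSL ℝ u).hasFDerivAt.comp θ hF).congr_fderiv ?_
  ext v
  simp [ContinuousLinearMap.adjoint_inner_left]

lemma hasGradientAt_const_mul {f : E → ℝ} {G θ : E} (hf : HasGradientAt f G θ) (c : ℝ) :
    HasGradientAt (fun η => c * f η) (c • G) θ := by
  rw [hasGradientAt_iff_hasFDerivAt, map_smul]
  exact hf.hasFDerivAt.const_mul c

lemma hasDerivAt_comp_add_smul {f : E → ℝ} {G x u : E} {s : ℝ}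
    (hf : HasGradientAt f G (x + s • u)) : HasDerivAt (fun s : ℝ => f (x + s • u)) ⟪G, u⟫ s := by
  have hline : HasDerivAt (fun s : ℝ => x + s • u) u s := by
    simpa using ((hasDerivAt_id s).smul_const u).const_add x
  exact hf.hasFDerivAt.comp_hasDerivAt s hline

lemma hasGradientAt_tsum {ι : Type*} {f : ι → E → ℝ} {G : ι → E → E} {b : ι → ℝ} {U : Set E}
    {θ : E} (hU : IsOpen U) (hθ : θ ∈ U) (hb : Summable b)
    (hG : ∀ i, ∀ η ∈ U, HasGradientAt (f i) (G i η) η) (hG_le : ∀ i, ∀ η ∈ U, ‖G i η‖ ≤ b i)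
    (hf : Summable fun i => f i θ) :
    HasGradientAt (fun η => ∑' i, f i η) (∑' i, G i θ) θ := by
  obtain ⟨ε, hε, hball⟩ := Metric.isOpen_iff.1 hU θ hθ
  have hGsum : HasSum (fun i => G i θ) (∑' i, G i θ) :=
    (Summable.of_norm_bounded hb fun i => hG_le i θ hθ).hasSum
  have hderiv := hasFDerivAt_tsum_of_isPreconnected (𝕜 := ℝ)
    (f' := fun i η => InnerProductSpace.toDual ℝ E (G i η)) hb Metric.isOpen_ball
    (convex_ball θ ε).isPreconnected (fun i η hη => (hG i η (hball hη)).hasFDerivAt)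
    (fun i η hη => by simpa using hG_le i η (hball hη)) (Metric.mem_ball_self hε) hf
    (Metric.mem_ball_self hε)
  exact hderiv.congr_fderiv
    (hGsum.map (InnerProductSpace.toDual ℝ E) (InnerProductSpace.toDual ℝ E).continuous).tsum_eq

lemma le_add_add_half_of_second_deriv_le {f f' f'' : ℝ → ℝ} {K : ℝ}
    (hf : ∀ s ∈ Set.Icc (0 : ℝ) 1, HasDerivAt f (f' s) s)
    (hf' : ∀ s ∈ Set.Icc (0 : ℝ) 1, HasDerivAt f' (f'' s) s)
    (hK : ∀ s ∈ Set.Icc (0 : ℝ) 1, f'' s ≤ K) : f 1 ≤ f 0 + f' 0 + K / 2 := by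
  have hzero : (0 : ℝ) ∈ Set.Icc (0 : ℝ) 1 := ⟨le_rfl, zero_le_one⟩
  have hderiv' (s : ℝ) (hs : s ∈ Set.Icc (0 : ℝ) 1) :
      HasDerivAt (fun s => f' s - K * s) (f'' s - K) s := by
    simpa using (hf' s hs).fun_sub ((hasDerivAt_id s).const_mul K)
  have hderiv (s : ℝ) (hs : s ∈ Set.Icc (0 : ℝ) 1) :
      HasDerivAt (fun s => f s - f' 0 * s - K / 2 * s ^ 2) (f' s - f' 0 - K * s) s := by
    refine (((hf s hs).fun_sub ((hasDerivAt_id s).const_mul (f' 0))).fun_sub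
      (((hasDerivAt_id s).fun_pow 2).const_mul (K / 2))).congr_deriv ?_
    simp only [id, Nat.cast_ofNat]
    ring
  have hanti' : AntitoneOn (fun s => f' s - K * s) (Set.Icc 0 1) :=
    antitoneOn_of_hasDerivWithinAt_nonpos (convex_Icc 0 1)
      (fun s hs => (hderiv' s hs).continuousAt.continuousWithinAt)
      (fun s hs => (hderiv' s (interior_subset hs)).hasDerivWithinAt)
      (fun s hs => sub_nonpos.2 (hK s (interior_subset hs)))
  have hanti : AntitoneOn (fun s => f s - f' 0 * s - K / 2 * s ^ 2) (Set.Icc 0 1) :=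
    antitoneOn_of_hasDerivWithinAt_nonpos (convex_Icc 0 1)
      (fun s hs => (hderiv s hs).continuousAt.continuousWithinAt)
      (fun s hs => (hderiv s (interior_subset hs)).hasDerivWithinAt)
      (fun s hs => by
        have hs' := interior_subset hs
        have hle := hanti' hzero hs' hs'.1
        simp only [mul_zero, sub_zero] at hle
        linarith)
  have hle := hanti hzero ⟨zero_le_one, le_rfl⟩ zero_le_one
  simp only at hle
  linarith

lemma le_add_inner_add_half_of_hasGradientAt {f : E → ℝ} {G D : E → E} {s : Set E} {x y : E}
    {K : ℝ} (hs : Convex ℝ s) (hx : x ∈ s) (hy : y ∈ s)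
    (hG : ∀ z ∈ s, HasGradientAt f (G z) z)
    (hD : ∀ z ∈ s, HasGradientAt (fun η => ⟪x - y, G η⟫) (D z) z)
    (hK : ∀ z ∈ s, ⟪x - y, D z⟫ ≤ K) : f x ≤ f y + ⟪G y, x - y⟫ + K / 2 := by
  have hmem (r : ℝ) (hr : r ∈ Set.Icc (0 : ℝ) 1) : y + r • (x - y) ∈ s :=
    hs.add_smul_sub_mem hy hx hr
  have hle := le_add_add_half_of_second_deriv_le (K := K)
    (fun r hr => hasDerivAt_comp_add_smul (hG _ (hmem r hr)))
    (f'' := fun r => ⟪D (y + r • (x - y)), x - y⟫)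
    (fun r hr => by
      simpa only [real_inner_comm] using hasDerivAt_comp_add_smul (hD _ (hmem r hr)))
    (fun r hr => by simpa only [real_inner_comm] using hK _ (hmem r hr))
  simpa using hle

end HilbertCalculus

section RealInequalities

lemma convexOn_cosh : ConvexOn ℝ Set.univ Real.cosh := by
  have hneg : ConvexOn ℝ Set.univ fun x : ℝ => Real.exp (-x) :=
    convexOn_exp.comp_linearMap (-LinearMap.id)
  have hsum : Real.cosh = (1 / 2 : ℝ) • (Real.exp + fun x => Real.exp (-x)) := by
    ext x
    simp only [Real.cosh_eq, Pi.smul_apply, Pi.add_apply, smul_eq_mul]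
    ring
  rw [hsum]
  exact (convexOn_exp.add hneg).smul (by norm_num)

lemma cosh_mul_norm_sum_le {E ι : Type*} [SeminormedAddCommGroup E] {s : Finset ι} {σ : ι → ℝ}
    (hs : s.Nonempty) (hσ : ∀ i ∈ s, 0 < σ i) (c : ℝ) (x : ι → E) :
    Real.cosh (c * ‖∑ i ∈ s, x i‖) ≤
      ∑ i ∈ s, σ i / (∑ j ∈ s, σ j) * Real.cosh (c * (∑ j ∈ s, σ j) / σ i * ‖x i‖) := by
  set a := ∑ j ∈ s, σ j
  have ha₀ : 0 < a := Finset.sum_pos hσ hs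
  have hweights : ∑ i ∈ s, σ i / a = 1 := by rw [← Finset.sum_div, div_self ha₀.ne']
  have hjensen := convexOn_cosh.map_sum_le (p := fun i : ι => c * a / σ i * ‖x i‖)
    (fun i hi => (div_pos (hσ i hi) ha₀).le) hweights fun _ _ => Set.mem_univ _
  have hterm (i : ι) (hi : i ∈ s) : (σ i / a) • (c * a / σ i * ‖x i‖) = c * ‖x i‖ := by
    have := (hσ i hi).ne'
    rw [smul_eq_mul]
    field_simp
  rw [Finset.sum_congr rfl hterm, ← Finset.mul_sum] at hjensen
  refine le_trans ?_ hjensen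
  rw [Real.cosh_le_cosh, abs_mul, abs_mul, abs_norm]
  exact mul_le_mul_of_nonneg_left ((norm_sum_le s x).trans (le_abs_self _)) (abs_nonneg c)

/-- Compare the power series of `cosh` in the squares of the arguments: every power
`x ^ n` is convex. -/
lemma cosh_le_of_sq_le {w p q a b : ℝ} (ha : 0 ≤ a) (hb : 0 ≤ b) (hab : a + b = 1)
    (h : w ^ 2 ≤ a * p ^ 2 + b * q ^ 2) :
    Real.cosh w ≤ a * Real.cosh p + b * Real.cosh q := by
  refine hasSum_le (fun n => ?_) (Real.hasSum_cosh w)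
    (((Real.hasSum_cosh p).mul_left a).add ((Real.hasSum_cosh q).mul_left b))
  have hpow : (a * p ^ 2 + b * q ^ 2) ^ n ≤ a * (p ^ 2) ^ n + b * (q ^ 2) ^ n :=
    (convexOn_pow n).2 (sq_nonneg p) (sq_nonneg q) ha hb hab
  rw [pow_mul, pow_mul, pow_mul, ← mul_div_assoc, ← mul_div_assoc, ← add_div]
  gcongr
  exact (pow_le_pow_left₀ (sq_nonneg w) h n).trans hpow

lemma cosh_le_of_sq_le_add_mul {w p q s : ℝ} (hs : |s| ≤ 1)
    (h : w ^ 2 ≤ p ^ 2 + q ^ 2 + 2 * (s * (p * q))) :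
    Real.cosh w ≤ Real.cosh p * Real.cosh q + s * (Real.sinh p * Real.sinh q) := by
  obtain ⟨hs₁, hs₂⟩ := abs_le.1 hs
  have := cosh_le_of_sq_le (w := w) (p := p + q) (q := p - q) (a := (1 + s) / 2)
    (b := (1 - s) / 2) (by linarith) (by linarith) (by ring) (h.trans_eq (by ring))
  rw [Real.cosh_add, Real.cosh_sub] at this
  linarith

lemma cosh_add_le_two_mul (x y : ℝ) :
    Real.cosh (x + y) ≤ 2 * (Real.cosh x * Real.cosh y) := by
  linarith [Real.cosh_pos (x - y), Real.cosh_add x y, Real.cosh_sub x y]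

lemma exp_le_two_mul_cosh (x : ℝ) : Real.exp x ≤ 2 * Real.cosh x := by
  linarith [Real.exp_pos (-x), Real.cosh_eq x]

lemma exp_sub_self_le (x : ℝ) : Real.exp x - x ≤ 2 * Real.cosh x - 1 := by
  linarith [Real.add_one_le_exp (-x), Real.cosh_eq x]

lemma cosh_sub_mul_sinh_le_one (x : ℝ) : Real.cosh x - x * Real.sinh x ≤ 1 := by
  have hpos : Real.exp x * (1 - x) ≤ 1 := by
    have := mul_le_mul_of_nonneg_left (Real.one_sub_le_exp_neg x) (Real.exp_pos x).le
    rwa [← Real.exp_add, add_neg_cancel, Real.exp_zero] at this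
  have hneg : Real.exp (-x) * (x + 1) ≤ 1 := by
    have := mul_le_mul_of_nonneg_left (Real.add_one_le_exp x) (Real.exp_pos (-x)).le
    rwa [← Real.exp_add, neg_add_cancel, Real.exp_zero] at this
  rw [Real.cosh_eq, Real.sinh_eq]
  linarith

lemma one_add_sq_div_two_le_cosh (x : ℝ) : 1 + x ^ 2 / 2 ≤ Real.cosh x := by
  have hle : ∑ n ∈ Finset.range 2, x ^ (2 * n) / (2 * n).factorial ≤ Real.cosh x :=
    sum_le_hasSum _ (fun n _ => by rw [pow_mul]; positivity) (Real.hasSum_cosh x)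
  simpa [Finset.sum_range_succ] using hle

lemma le_of_one_add_mul_le_exp_mul {a b : ℝ}
    (h : ∀ u, 0 ≤ u → 1 + u * a ≤ Real.exp (u * b)) : a ≤ b := by
  have hderiv : HasDerivAt (fun u => Real.exp (u * b)) b 0 := by
    simpa using ((hasDerivAt_id (0 : ℝ)).mul_const b).exp
  refine ge_of_tendsto hderiv.tendsto_slope_zero_right ?_
  filter_upwards [self_mem_nhdsWithin] with u (hu : 0 < u)
  simp only [zero_add, zero_mul, Real.exp_zero, smul_eq_mul]
  rw [← div_eq_inv_mul, le_div_iff₀ hu]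
  linarith [h u hu.le]

lemma one_add_two_mul_exp_mul_le {x : ℝ} (hx₀ : 0 ≤ x) (hx : x ≤ 1 / 3) :
    1 + 2 * (Real.exp x * (Real.exp (x ^ 2 / 2) - 1)) ≤ Real.exp (3 * (x ^ 2 / 2)) := by
  obtain ⟨z, hz⟩ : ∃ z, z = x ^ 2 / 2 := ⟨_, rfl⟩
  rw [← hz]
  have hz₀ : 0 ≤ z := by rw [hz]; positivity
  have hz₁ : z ≤ 1 / 18 := by nlinarith
  have hexp : Real.exp x ≤ 1.4 := by
    have hcube : Real.exp (1 / 3) ^ 3 ≤ (1.4 : ℝ) ^ 3 := by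
      rw [← Real.exp_nat_mul]
      norm_num
      linarith [Real.exp_one_lt_d9]
    exact (Real.exp_le_exp.2 hx).trans (le_of_pow_le_pow_left₀ three_ne_zero (by norm_num) hcube)
  have hquad : Real.exp z - 1 ≤ z + z ^ 2 := by
    have := (abs_le.1 (Real.abs_exp_sub_one_sub_id_le (x := z)
      (by rw [abs_of_nonneg hz₀]; linarith))).2
    linarith
  have hmul : Real.exp x * (Real.exp z - 1) ≤ 1.4 * (z + z ^ 2) :=
    mul_le_mul hexp hquad (by linarith [Real.add_one_le_exp z]) (by norm_num)
  nlinarith [Real.add_one_le_exp (3 * z)]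

lemma two_mul_exp_le_of_sixteen_le {y : ℝ} (hy : 16 ≤ y) :
    2 * Real.exp (-(y / 6)) ≤ Real.exp (1 / 4 - y / 8) := by
  nth_rewrite 1 [← Real.exp_log two_pos]
  rw [← Real.exp_add, Real.exp_le_exp]
  linarith [Real.log_two_lt_d9]

lemma one_div_le_exp_of_le_sixteen {y : ℝ} (hy₂ : 2 ≤ y) (hy₁₆ : y ≤ 16) :
    1 / y ≤ Real.exp (1 / 4 - y / 8) := by
  obtain ⟨s, hs⟩ : ∃ s, s = y / 8 - 1 / 4 := ⟨_, rfl⟩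
  have hexp : Real.exp s ≤ 1 + 4 * s := by
    have hchord := convexOn_exp.2 (Set.mem_univ 0) (Set.mem_univ 2)
      (by linarith : 0 ≤ 1 - s / 2) (by linarith : 0 ≤ s / 2) (by ring)
    have hexp_two : Real.exp 2 ≤ 9 := by
      rw [show (2 : ℝ) = 1 + 1 by norm_num, Real.exp_add]
      nlinarith [Real.exp_one_lt_d9, Real.exp_pos 1]
    simp only [smul_eq_mul, mul_zero, zero_add, Real.exp_zero] at hchord
    rw [div_mul_cancel₀ s two_ne_zero] at hchord
    nlinarith
  rw [show 1 / 4 - y / 8 = -s by rw [hs]; ring, Real.exp_neg, ← one_div]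
  exact one_div_le_one_div_of_le (Real.exp_pos s) (by linarith)

end RealInequalities

section CoshNorm

variable {E : Type*} [NormedAddCommGroup E] [InnerProductSpace ℝ E]

/-- The gradient of `z ↦ cosh ‖z‖`; at the origin the junk value `sinh 0 / 0 = 0` is harmless, as
the vector it multiplies vanishes. -/
noncomputable def coshNormGrad (z : E) : E := (Real.sinh ‖z‖ / ‖z‖) • z

@[simp] lemma coshNormGrad_neg (z : E) : coshNormGrad (-z) = -coshNormGrad z := by
  simp [coshNormGrad]

lemma norm_coshNormGrad (z : E) : ‖coshNormGrad z‖ = Real.sinh ‖z‖ := by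
  have : 0 ≤ Real.sinh ‖z‖ / ‖z‖ :=
    div_nonneg (Real.sinh_nonneg_iff.2 (norm_nonneg z)) (norm_nonneg z)
  rw [coshNormGrad, norm_smul, Real.norm_of_nonneg this]
  exact div_mul_cancel_of_imp fun h => by rw [h, Real.sinh_zero]

lemma inner_coshNormGrad_self (z : E) : ⟪coshNormGrad z, z⟫ = ‖z‖ * Real.sinh ‖z‖ := by
  rw [coshNormGrad, real_inner_smul_left, real_inner_self_eq_norm_sq, sq, ← mul_assoc,
    div_mul_cancel_of_imp fun h => by rw [h, Real.sinh_zero], mul_comm]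

lemma continuous_coshNormGrad : Continuous (coshNormGrad : E → E) := by
  refine continuous_iff_continuousAt.2 fun z => ?_
  rcases eq_or_ne z 0 with rfl | hz
  · have hsinh : Continuous fun z : E => Real.sinh ‖z‖ :=
      Real.continuous_sinh.comp continuous_norm
    refine tendsto_iff_norm_sub_tendsto_zero.2 ?_
    rw [show coshNormGrad (0 : E) = 0 from smul_zero _]
    simpa [norm_coshNormGrad] using hsinh.tendsto 0
  · exact ((Real.continuous_sinh.comp continuous_norm).continuousAt.div
      continuous_norm.continuousAt (norm_ne_zero_iff.2 hz)).smul continuousAt_id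

lemma cosh_norm_add_le (z : E) {y : E} {b : ℝ} (hy : ‖y‖ ≤ b) :
    Real.cosh ‖z + y‖ ≤
      Real.cosh ‖z‖ * Real.cosh b + Real.sinh b / b * ⟪coshNormGrad z, y⟫ := by
  rcases eq_or_ne z 0 with rfl | hz
  · simpa [coshNormGrad, abs_of_nonneg ((norm_nonneg y).trans hy)] using hy
  rcases ((norm_nonneg y).trans hy).eq_or_lt with rfl | hb
  · simp [norm_le_zero_iff.1 hy]
  have hzb : 0 < ‖z‖ * b := mul_pos (norm_pos_iff.2 hz) hb
  have hinner : ⟪z, y⟫ = ⟪z, y⟫ / (‖z‖ * b) * (‖z‖ * b) := (div_mul_cancel₀ _ hzb.ne').symm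
  have hcos : |⟪z, y⟫ / (‖z‖ * b)| ≤ 1 := by
    rw [abs_div, abs_of_pos hzb, div_le_one hzb]
    exact (abs_real_inner_le_norm z y).trans (by gcongr)
  have hsq : ‖z + y‖ ^ 2 ≤ ‖z‖ ^ 2 + b ^ 2 + 2 * (⟪z, y⟫ / (‖z‖ * b) * (‖z‖ * b)) := by
    rw [norm_add_sq_real, ← hinner]
    have : ‖y‖ ^ 2 ≤ b ^ 2 := by gcongr
    linarith
  refine (cosh_le_of_sq_le_add_mul hcos hsq).trans_eq ?_
  rw [coshNormGrad, real_inner_smul_left]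
  field_simp

lemma cosh_norm_add_le_sinh (z y : E) :
    Real.cosh ‖z + y‖ ≤ Real.cosh ‖z‖ * Real.cosh ‖y‖
      + Real.sinh ‖z‖ * (Real.sinh ‖y‖ - ‖y‖) + ⟪coshNormGrad z, y⟫ := by
  rcases eq_or_ne y 0 with rfl | hy
  · simp
  have hy₀ : 0 < ‖y‖ := norm_pos_iff.2 hy
  have hsinh : 0 ≤ Real.sinh ‖y‖ - ‖y‖ := sub_nonneg.2 (Real.self_le_sinh_iff.2 hy₀.le)
  have hinner : (Real.sinh ‖y‖ - ‖y‖) / ‖y‖ * ⟪coshNormGrad z, y⟫ ≤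
      Real.sinh ‖z‖ * (Real.sinh ‖y‖ - ‖y‖) := calc
    _ ≤ (Real.sinh ‖y‖ - ‖y‖) / ‖y‖ * (Real.sinh ‖z‖ * ‖y‖) := by
        gcongr
        exact (real_inner_le_norm _ _).trans_eq (by rw [norm_coshNormGrad])
    _ = _ := by field_simp
  have hsplit : Real.sinh ‖y‖ / ‖y‖ = 1 + (Real.sinh ‖y‖ - ‖y‖) / ‖y‖ := by field_simp; ring
  have hbound := cosh_norm_add_le z (le_refl ‖y‖)
  rw [hsplit] at hbound
  linarith

lemma cosh_norm_add_le_exp (z y : E) :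
    Real.cosh ‖z + y‖ ≤
      Real.cosh ‖z‖ * (Real.exp ‖y‖ - ‖y‖) + ⟪coshNormGrad z, y⟫ := by
  have hsinh : 0 ≤ Real.sinh ‖y‖ - ‖y‖ := sub_nonneg.2 (Real.self_le_sinh_iff.2 (norm_nonneg y))
  have hmul := mul_le_mul_of_nonneg_right (Real.sinh_lt_cosh (x := ‖z‖)).le hsinh
  rw [← Real.cosh_add_sinh]
  linarith [cosh_norm_add_le_sinh z y]

lemma cosh_norm_sub_le (x z : E) :
    Real.cosh ‖x - z‖ ≤
      Real.exp ‖z‖ * Real.cosh ‖x‖ - Real.sinh ‖z‖ - ⟪coshNormGrad z, x⟫ := by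
  have hexp : Real.sinh ‖x‖ - ‖x‖ ≤ Real.cosh ‖x‖ - 1 := by
    have := Real.add_one_le_exp (-‖x‖)
    rw [← Real.cosh_sub_sinh] at this
    linarith
  have hmul := mul_le_mul_of_nonneg_left hexp (Real.sinh_nonneg_iff.2 (norm_nonneg z))
  have hadd := cosh_norm_add_le_sinh (-z) x
  rw [neg_add_eq_sub, norm_neg, coshNormGrad_neg, inner_neg_left] at hadd
  rw [← Real.cosh_add_sinh]
  linarith

end CoshNorm

section SecondMoments

variable {Ω E : Type*} [MeasurableSpace Ω] {μ : Measure Ω} [IsProbabilityMeasure μ]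
  [NormedAddCommGroup E] [InnerProductSpace ℝ E] [CompleteSpace E]

lemma norm_integral_le_of_integral_inner_sq_le {X : Ω → E} (hX : MemLp X 2 μ) {K : ℝ} (hK : 0 ≤ K)
    (h : ∀ u, ∫ ω, ⟪u, X ω⟫ ^ 2 ∂μ ≤ (‖u‖ * K) ^ 2) : ‖∫ ω, X ω ∂μ‖ ≤ K := by
  set v := ∫ ω, X ω ∂μ with hv
  have hinner : ∫ ω, ⟪v, X ω⟫ ∂μ = ‖v‖ ^ 2 := by
    rw [integral_inner (hX.integrable one_le_two), ← hv, real_inner_self_eq_norm_sq]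
  have hvar := variance_nonneg (fun ω => ⟪v, X ω⟫) μ
  rw [variance_eq_sub (hX.const_inner v), hinner, sub_nonneg, sq ‖v‖] at hvar
  have hmul : ‖v‖ * ‖v‖ ≤ ‖v‖ * K := le_of_sq_le_sq (hvar.trans (h v)) (by positivity)
  rcases (norm_nonneg v).eq_or_lt with hv0 | hv0
  · exact hv0 ▸ hK
  · exact le_of_mul_le_mul_left hmul hv0

end SecondMoments

section IndependentSums

variable {Ω E : Type*} [MeasurableSpace Ω] {μ : Measure Ω} [NormedAddCommGroup E]

lemma memLp_two_of_integrable_cosh_norm {X : Ω → E} (hX : AEStronglyMeasurable X μ)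
    (hcosh : Integrable (fun ω => Real.cosh ‖X ω‖) μ) : MemLp X 2 μ := by
  refine (memLp_two_iff_integrable_sq_norm hX).2
    ((hcosh.const_mul 2).mono' (hX.norm.pow 2) (.of_forall fun ω => ?_))
  rw [Real.norm_of_nonneg (sq_nonneg _)]
  linarith [one_add_sq_div_two_le_cosh ‖X ω‖]

lemma integrable_exp_norm_of_integrable_cosh_norm {X : Ω → E} (hX : AEStronglyMeasurable X μ)
    (hcosh : Integrable (fun ω => Real.cosh ‖X ω‖) μ) :
    Integrable (fun ω => Real.exp ‖X ω‖) μ := by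
  refine (hcosh.const_mul 2).mono' (Real.continuous_exp.comp_aestronglyMeasurable hX.norm)
    (.of_forall fun ω => ?_)
  rw [Real.norm_of_nonneg (Real.exp_pos _).le]
  exact exp_le_two_mul_cosh _

lemma integrable_cosh_norm_sub_const {X : Ω → E} (hX : AEStronglyMeasurable X μ)
    (hcosh : Integrable (fun ω => Real.cosh ‖X ω‖) μ) (z : E) :
    Integrable (fun ω => Real.cosh ‖X ω - z‖) μ := by
  refine (hcosh.mul_const (Real.cosh ‖z‖)).const_mul 2 |>.mono'
    (by fun_prop) (.of_forall fun ω => ?_)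
  rw [Real.norm_of_nonneg (Real.cosh_pos _).le]
  refine le_trans ?_ (cosh_add_le_two_mul _ _)
  rw [Real.cosh_le_cosh, abs_of_nonneg (norm_nonneg _), abs_of_nonneg (by positivity)]
  exact norm_sub_le _ _

lemma integrable_cosh_norm_add_of_indepFun [MeasurableSpace E] [BorelSpace E]
    {X Y : Ω → E} (hind : IndepFun X Y μ) (hX : AEStronglyMeasurable X μ)
    (hY : AEStronglyMeasurable Y μ)
    (hX_cosh : Integrable (fun ω => Real.cosh ‖X ω‖) μ)
    (hY_cosh : Integrable (fun ω => Real.cosh ‖Y ω‖) μ) :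
    Integrable (fun ω => Real.cosh ‖X ω + Y ω‖) μ := by
  have hind_cosh : IndepFun (fun ω => Real.cosh ‖X ω‖) (fun ω => Real.cosh ‖Y ω‖) μ :=
    hind.comp (φ := fun x => Real.cosh ‖x‖) (ψ := fun x => Real.cosh ‖x‖)
      (by fun_prop) (by fun_prop)
  refine ((hind_cosh.integrable_mul hX_cosh hY_cosh).const_mul 2).mono' (by fun_prop)
    (.of_forall fun ω => ?_)
  rw [Real.norm_of_nonneg (Real.cosh_pos _).le]
  refine le_trans ?_ (cosh_add_le_two_mul _ _)
  rw [Real.cosh_le_cosh, abs_of_nonneg (norm_nonneg _), abs_of_nonneg (by positivity)]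
  exact norm_add_le _ _

variable [InnerProductSpace ℝ E] [CompleteSpace E] [IsProbabilityMeasure μ]

lemma integral_norm_sub_integral_sq {X : Ω → E} (hX : MemLp X 2 μ) :
    ∫ ω, ‖X ω - ∫ ω', X ω' ∂μ‖ ^ 2 ∂μ = ∫ ω, ‖X ω‖ ^ 2 ∂μ - ‖∫ ω, X ω ∂μ‖ ^ 2 := by
  have hint : Integrable X μ := hX.integrable one_le_two
  have hsq : Integrable (fun ω => ‖X ω‖ ^ 2) μ := hX.integrable_norm_pow two_ne_zero
  have hinner : Integrable (fun ω => 2 * ⟪∫ ω', X ω' ∂μ, X ω⟫) μ :=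
    (hint.const_inner (𝕜 := ℝ) _).const_mul 2
  simp_rw [norm_sub_sq_real, fun ω => real_inner_comm (∫ ω', X ω' ∂μ) (X ω)]
  have hdiff : Integrable (fun ω => ‖X ω‖ ^ 2 - 2 * ⟪∫ ω', X ω' ∂μ, X ω⟫) μ := hsq.sub hinner
  rw [integral_add hdiff (integrable_const _), integral_sub hsq hinner,
    integral_const_mul, integral_inner hint, real_inner_self_eq_norm_sq, integral_const,
    probReal_univ, one_smul]
  ring

lemma integral_cosh_norm_sub_integral_le {X : Ω → E} (hX : AEStronglyMeasurable X μ)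
    (hcosh : Integrable (fun ω => Real.cosh ‖X ω‖) μ) :
    ∫ ω, Real.cosh ‖X ω - ∫ ω', X ω' ∂μ‖ ∂μ ≤
      1 + Real.exp ‖∫ ω, X ω ∂μ‖ * (∫ ω, Real.cosh ‖X ω‖ ∂μ - 1) := by
  have hint : Integrable X μ :=
    (memLp_two_of_integrable_cosh_norm hX hcosh).integrable one_le_two
  set z := ∫ ω, X ω ∂μ with hz
  have hinner : Integrable (fun ω => ⟪coshNormGrad z, X ω⟫) μ := hint.const_inner (𝕜 := ℝ) _
  have hdiff : Integrable (fun ω => Real.exp ‖z‖ * Real.cosh ‖X ω‖ - Real.sinh ‖z‖) μ :=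
    (hcosh.const_mul _).sub (integrable_const _)
  calc ∫ ω, Real.cosh ‖X ω - z‖ ∂μ
      ≤ ∫ ω, (Real.exp ‖z‖ * Real.cosh ‖X ω‖ - Real.sinh ‖z‖ - ⟪coshNormGrad z, X ω⟫) ∂μ :=
        integral_mono (integrable_cosh_norm_sub_const hX hcosh z) (hdiff.sub hinner)
          fun ω => cosh_norm_sub_le (X ω) z
    _ = Real.exp ‖z‖ * ∫ ω, Real.cosh ‖X ω‖ ∂μ - Real.sinh ‖z‖ - Real.sinh ‖z‖ * ‖z‖ := by
        rw [integral_sub hdiff hinner,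
          integral_sub (hcosh.const_mul _) (integrable_const _), integral_const_mul,
          integral_inner hint, ← hz, inner_coshNormGrad_self, integral_const, probReal_univ,
          one_smul, mul_comm ‖z‖]
    _ ≤ 1 + Real.exp ‖z‖ * (∫ ω, Real.cosh ‖X ω‖ ∂μ - 1) := by
        have := cosh_sub_mul_sinh_le_one ‖z‖
        rw [← Real.cosh_add_sinh]
        linarith

variable [MeasurableSpace E] [BorelSpace E]

lemma integral_cosh_norm_add_le_of_indepFun {X Y : Ω → E} (hind : IndepFun X Y μ)
    (hX : AEStronglyMeasurable X μ) (hY : AEStronglyMeasurable Y μ)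
    (hX_cosh : Integrable (fun ω => Real.cosh ‖X ω‖) μ)
    (hY_cosh : Integrable (fun ω => Real.cosh ‖Y ω‖) μ) (hY_zero : ∫ ω, Y ω ∂μ = 0) :
    ∫ ω, Real.cosh ‖X ω + Y ω‖ ∂μ ≤
      (∫ ω, Real.cosh ‖X ω‖ ∂μ) * ∫ ω, (Real.exp ‖Y ω‖ - ‖Y ω‖) ∂μ := by
  have hY_int : Integrable Y μ :=
    (memLp_two_of_integrable_cosh_norm hY hY_cosh).integrable one_le_two
  have hexp : Integrable (fun ω => Real.exp ‖Y ω‖ - ‖Y ω‖) μ :=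
    (integrable_exp_norm_of_integrable_cosh_norm hY hY_cosh).sub hY_int.norm
  have hgrad : Integrable (fun ω => coshNormGrad (X ω)) μ :=
    hX_cosh.mono' (continuous_coshNormGrad.comp_aestronglyMeasurable hX) <| .of_forall fun ω => by
      rw [norm_coshNormGrad]
      exact (Real.sinh_lt_cosh (x := ‖X ω‖)).le
  have hind_exp : IndepFun (fun ω => Real.cosh ‖X ω‖) (fun ω => Real.exp ‖Y ω‖ - ‖Y ω‖) μ :=
    hind.comp (φ := fun x => Real.cosh ‖x‖) (ψ := fun y => Real.exp ‖y‖ - ‖y‖)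
      (by fun_prop) (by fun_prop)
  have hind_grad : IndepFun (fun ω => coshNormGrad (X ω)) Y μ :=
    hind.comp continuous_coshNormGrad.measurable measurable_id
  have hmul : Integrable (fun ω => Real.cosh ‖X ω‖ * (Real.exp ‖Y ω‖ - ‖Y ω‖)) μ :=
    hind_exp.integrable_mul hX_cosh hexp
  have hinner : Integrable (fun ω => ⟪coshNormGrad (X ω), Y ω⟫) μ :=
    hind_grad.integrable_bilin hgrad hY_int (innerSL ℝ)
  calc ∫ ω, Real.cosh ‖X ω + Y ω‖ ∂μ
      ≤ ∫ ω, (Real.cosh ‖X ω‖ * (Real.exp ‖Y ω‖ - ‖Y ω‖) + ⟪coshNormGrad (X ω), Y ω⟫) ∂μ :=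
        integral_mono (integrable_cosh_norm_add_of_indepFun hind hX hY hX_cosh hY_cosh)
          (hmul.add hinner) fun ω => cosh_norm_add_le_exp (X ω) (Y ω)
    _ = (∫ ω, Real.cosh ‖X ω‖ ∂μ) * ∫ ω, (Real.exp ‖Y ω‖ - ‖Y ω‖) ∂μ := by
        have hzero : ∫ ω, ⟪coshNormGrad (X ω), Y ω⟫ ∂μ = 0 :=
          (hind_grad.integral_bilin hgrad hY_int (innerSL ℝ)).trans (by
            rw [hY_zero, map_zero])
        rw [integral_add hmul hinner, hzero, add_zero,
          hind_exp.integral_fun_mul_eq_mul_integral hX_cosh.1 hexp.1]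

lemma integral_norm_add_sq_of_indepFun {X Y : Ω → E} (hind : IndepFun X Y μ)
    (hX : MemLp X 2 μ) (hY : MemLp Y 2 μ) (hY_zero : ∫ ω, Y ω ∂μ = 0) :
    ∫ ω, ‖X ω + Y ω‖ ^ 2 ∂μ = ∫ ω, ‖X ω‖ ^ 2 ∂μ + ∫ ω, ‖Y ω‖ ^ 2 ∂μ := by
  have hX_int := hX.integrable one_le_two
  have hY_int := hY.integrable one_le_two
  have hinner : Integrable (fun ω => 2 * ⟪X ω, Y ω⟫) μ :=
    (hind.integrable_bilin hX_int hY_int (innerSL ℝ)).const_mul 2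
  have hzero : ∫ ω, ⟪X ω, Y ω⟫ ∂μ = 0 :=
    (hind.integral_bilin hX_int hY_int (innerSL ℝ)).trans (by rw [hY_zero, map_zero])
  have hX_sq : Integrable (fun ω => ‖X ω‖ ^ 2) μ := hX.integrable_norm_pow two_ne_zero
  have hY_sq : Integrable (fun ω => ‖Y ω‖ ^ 2) μ := hY.integrable_norm_pow two_ne_zero
  have hadd : Integrable (fun ω => ‖X ω‖ ^ 2 + 2 * ⟪X ω, Y ω⟫) μ := hX_sq.add hinner
  simp_rw [norm_add_sq_real]
  rw [integral_add hadd hY_sq, integral_add hX_sq hinner, integral_const_mul, hzero, mul_zero,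
    add_zero]

variable [SecondCountableTopology E] {ι : Type*} {Y : ι → Ω → E}

lemma iIndepFun_integral_cosh_norm_sum_le (hind : iIndepFun Y μ)
    (hY : ∀ i, AEStronglyMeasurable (Y i) μ)
    (hcosh : ∀ i, Integrable (fun ω => Real.cosh ‖Y i ω‖) μ)
    (hzero : ∀ i, ∫ ω, Y i ω ∂μ = 0) (s : Finset ι) :
    Integrable (fun ω => Real.cosh ‖∑ i ∈ s, Y i ω‖) μ ∧
      ∫ ω, Real.cosh ‖∑ i ∈ s, Y i ω‖ ∂μ ≤ ∏ i ∈ s, ∫ ω, (Real.exp ‖Y i ω‖ - ‖Y i ω‖) ∂μ := by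
  classical
  induction s using Finset.induction_on with
  | empty => simp
  | insert i s hi ih =>
    have hind_sum : IndepFun (fun ω => ∑ j ∈ s, Y j ω) (Y i) μ := by
      simpa only [Finset.sum_fn] using
        hind.indepFun_finsetSum_of_notMem₀ (fun j => (hY j).aemeasurable) hi
    have hsum : AEStronglyMeasurable (fun ω => ∑ j ∈ s, Y j ω) μ :=
      Finset.aestronglyMeasurable_fun_sum _ fun j _ => hY j
    simp_rw [Finset.sum_insert hi, Finset.prod_insert hi, add_comm (Y i _)]
    refine ⟨integrable_cosh_norm_add_of_indepFun hind_sum hsum (hY i) ih.1 (hcosh i),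
      (integral_cosh_norm_add_le_of_indepFun hind_sum hsum (hY i) ih.1 (hcosh i)
        (hzero i)).trans ?_⟩
    rw [mul_comm]
    gcongr
    · exact integral_nonneg fun ω =>
        sub_nonneg.2 ((le_add_of_nonneg_right zero_le_one).trans (Real.add_one_le_exp ‖Y i ω‖))
    · exact ih.2

lemma iIndepFun_integral_norm_sum_sq (hind : iIndepFun Y μ) (hY : ∀ i, MemLp (Y i) 2 μ)
    (hzero : ∀ i, ∫ ω, Y i ω ∂μ = 0) (s : Finset ι) :
    ∫ ω, ‖∑ i ∈ s, Y i ω‖ ^ 2 ∂μ = ∑ i ∈ s, ∫ ω, ‖Y i ω‖ ^ 2 ∂μ := by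
  classical
  induction s using Finset.induction_on with
  | empty => simp
  | insert i s hi ih =>
    have hind_sum : IndepFun (fun ω => ∑ j ∈ s, Y j ω) (Y i) μ := by
      simpa only [Finset.sum_fn] using
        hind.indepFun_finsetSum_of_notMem₀ (fun j => (hY j).1.aemeasurable) hi
    simp_rw [Finset.sum_insert hi, add_comm (Y i _)]
    rw [integral_norm_add_sq_of_indepFun hind_sum (memLp_finsetSum s fun j _ => hY j) (hY i)
      (hzero i), ih, add_comm]

end IndependentSums

/-- A random vector whose norm has hyperbolic-cosine moments bounded as for a centred real Gaussian
of standard deviation `σ`. Integrability is a separate field because the Bochner integral of a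
non-integrable function is `0`. -/
structure HasSubgaussianNorm {Ω E : Type*} [MeasurableSpace Ω] [NormedAddCommGroup E]
    (X : Ω → E) (σ : ℝ) (μ : Measure Ω) : Prop where
  aestronglyMeasurable : AEStronglyMeasurable X μ
  integrable_cosh : ∀ c, Integrable (fun ω => Real.cosh (c * ‖X ω‖)) μ
  integral_cosh_le : ∀ c, ∫ ω, Real.cosh (c * ‖X ω‖) ∂μ ≤ Real.exp ((c * σ) ^ 2 / 2)

namespace HasSubgaussianNorm

section Basic

variable {Ω E : Type*} [MeasurableSpace Ω] {μ : Measure Ω} [NormedAddCommGroup E]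
  {X : Ω → E} {σ : ℝ}

lemma comp_hasLaw_iff {Ω' : Type*} [MeasurableSpace Ω'] {P : Measure Ω'} {τ : Ω' → Ω}
    (hτ : HasLaw τ μ P) (hX : AEStronglyMeasurable X μ) :
    HasSubgaussianNorm (X ∘ τ) σ P ↔ HasSubgaussianNorm X σ μ := by
  have hcosh (c : ℝ) : AEStronglyMeasurable (fun x => Real.cosh (c * ‖X x‖)) μ :=
    Real.continuous_cosh.comp_aestronglyMeasurable (hX.norm.const_mul c)
  obtain ⟨hmeas, rfl⟩ := hτ
  have hint (c : ℝ) := integrable_map_measure (hcosh c) hmeas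
  have hle (c : ℝ) := integral_map hmeas (hcosh c)
  refine ⟨fun h => ⟨hX, fun c => (hint c).2 (h.integrable_cosh c),
    fun c => (hle c).trans_le (h.integral_cosh_le c)⟩, fun h => ⟨hX.comp_aemeasurable hmeas,
    fun c => (hint c).1 (h.integrable_cosh c), fun c => (hle c).symm.trans_le ?_⟩⟩
  exact h.integral_cosh_le c

lemma of_norm_le {F : Type*} [NormedAddCommGroup F] {Y : Ω → F} (hX : HasSubgaussianNorm X σ μ)
    (hY : AEStronglyMeasurable Y μ) (hle : ∀ ω, ‖Y ω‖ ≤ ‖X ω‖) : HasSubgaussianNorm Y σ μ := by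
  have hcosh (c : ℝ) (ω : Ω) : Real.cosh (c * ‖Y ω‖) ≤ Real.cosh (c * ‖X ω‖) := by
    rw [Real.cosh_le_cosh, abs_mul, abs_mul, abs_norm, abs_norm]
    gcongr
    exact hle ω
  have hint (c : ℝ) : Integrable (fun ω => Real.cosh (c * ‖Y ω‖)) μ :=
    (hX.integrable_cosh c).mono' (Real.continuous_cosh.comp_aestronglyMeasurable
      (hY.norm.const_mul c)) (.of_forall fun ω => by
        rw [Real.norm_of_nonneg (Real.cosh_pos _).le]
        exact hcosh c ω)
  exact ⟨hY, hint, fun c =>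
    (integral_mono (hint c) (hX.integrable_cosh c) (hcosh c)).trans (hX.integral_cosh_le c)⟩

lemma mono {σ' : ℝ} (hX : HasSubgaussianNorm X σ μ) (hσ : |σ| ≤ |σ'|) :
    HasSubgaussianNorm X σ' μ := by
  refine ⟨hX.aestronglyMeasurable, hX.integrable_cosh, fun c => (hX.integral_cosh_le c).trans ?_⟩
  rw [Real.exp_le_exp, mul_pow, mul_pow]
  gcongr ?_ * ?_ / _
  exact sq_le_sq.2 hσ

lemma const_smul [NormedSpace ℝ E] (hX : HasSubgaussianNorm X σ μ) (a : ℝ) :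
    HasSubgaussianNorm (fun ω => a • X ω) (a * σ) μ := by
  have hcosh (c : ℝ) (ω : Ω) : Real.cosh (c * ‖a • X ω‖) = Real.cosh (c * a * ‖X ω‖) := by
    rw [norm_smul, Real.norm_eq_abs, ← Real.cosh_abs, ← Real.cosh_abs (c * a * _)]
    simp only [abs_mul, abs_abs, abs_norm, mul_assoc]
  refine ⟨hX.aestronglyMeasurable.const_smul a, fun c => ?_, fun c => ?_⟩
  · simpa only [hcosh] using hX.integrable_cosh (c * a)
  · simpa only [hcosh, mul_assoc] using hX.integral_cosh_le (c * a)

/-- Jensen's inequality for `cosh`, with weights proportional to the scales `σ i`. -/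
lemma finset_sum [IsProbabilityMeasure μ] {ι : Type*} {s : Finset ι} {X : ι → Ω → E}
    {σ : ι → ℝ} (hX : ∀ i ∈ s, HasSubgaussianNorm (X i) (σ i) μ) (hσ : ∀ i ∈ s, 0 < σ i) :
    HasSubgaussianNorm (fun ω => ∑ i ∈ s, X i ω) (∑ i ∈ s, σ i) μ := by
  rcases s.eq_empty_or_nonempty with rfl | hs
  · refine ⟨?_, fun c => ?_, fun c => ?_⟩ <;> simp [aestronglyMeasurable_const]
  set a := ∑ i ∈ s, σ i
  have hpt (c : ℝ) (ω : Ω) := cosh_mul_norm_sum_le hs hσ c (fun i => X i ω)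
  have hmeas : AEStronglyMeasurable (fun ω => ∑ i ∈ s, X i ω) μ :=
    s.aestronglyMeasurable_fun_sum fun i hi => (hX i hi).aestronglyMeasurable
  have hterm (c : ℝ) (i : ι) (hi : i ∈ s) :
      Integrable (fun ω => σ i / a * Real.cosh (c * a / σ i * ‖X i ω‖)) μ :=
    ((hX i hi).integrable_cosh _).const_mul _
  have hint (c : ℝ) : Integrable (fun ω => Real.cosh (c * ‖∑ i ∈ s, X i ω‖)) μ :=
    (integrable_finsetSum s (hterm c)).mono' (Real.continuous_cosh.comp_aestronglyMeasurable
      (hmeas.norm.const_mul c)) (.of_forall fun ω => by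
        rw [Real.norm_of_nonneg (Real.cosh_pos _).le]
        exact hpt c ω)
  refine ⟨hmeas, hint, fun c => ?_⟩
  calc ∫ ω, Real.cosh (c * ‖∑ i ∈ s, X i ω‖) ∂μ
      ≤ ∑ i ∈ s, σ i / a * ∫ ω, Real.cosh (c * a / σ i * ‖X i ω‖) ∂μ := by
        simp_rw [← integral_const_mul]
        rw [← integral_finsetSum s (hterm c)]
        exact integral_mono (hint c) (integrable_finsetSum s (hterm c)) (hpt c)
    _ ≤ ∑ i ∈ s, σ i / a * Real.exp ((c * a) ^ 2 / 2) := by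
        refine Finset.sum_le_sum fun i hi => mul_le_mul_of_nonneg_left ?_
          (div_nonneg (hσ i hi).le (Finset.sum_nonneg fun j hj => (hσ j hj).le))
        simpa only [div_mul_cancel₀ _ (hσ i hi).ne'] using
          (hX i hi).integral_cosh_le (c * a / σ i)
    _ = Real.exp ((c * a) ^ 2 / 2) := by
        rw [← Finset.sum_mul, ← Finset.sum_div, div_self (Finset.sum_pos hσ hs).ne', one_mul]

lemma memLp_two (hX : HasSubgaussianNorm X σ μ) : MemLp X 2 μ :=
  memLp_two_of_integrable_cosh_norm hX.aestronglyMeasurable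
    (by simpa using hX.integrable_cosh 1)

lemma integrable_cosh_sub_integral [NormedSpace ℝ E] (hX : HasSubgaussianNorm X σ μ) (c : ℝ) :
    Integrable (fun ω => Real.cosh ‖c • (X ω - ∫ ω', X ω' ∂μ)‖) μ := by
  have hcosh : Integrable (fun ω => Real.cosh ‖c • X ω‖) μ := by
    simpa only [norm_smul, Real.norm_eq_abs] using hX.integrable_cosh |c|
  simp_rw [smul_sub]
  exact integrable_cosh_norm_sub_const (hX.aestronglyMeasurable.const_smul c) hcosh _

variable [IsProbabilityMeasure μ]

lemma integrable (hX : HasSubgaussianNorm X σ μ) : Integrable X μ :=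
  hX.memLp_two.integrable one_le_two

lemma integral_norm_sq_le (hX : HasSubgaussianNorm X σ μ) :
    ∫ ω, ‖X ω‖ ^ 2 ∂μ ≤ σ ^ 2 := by
  have hsq : Integrable (fun ω => ‖X ω‖ ^ 2) μ := hX.memLp_two.integrable_norm_pow two_ne_zero
  refine le_of_one_add_mul_le_exp_mul fun u hu => ?_
  have hu_sq : √(2 * u) ^ 2 = 2 * u := Real.sq_sqrt (by positivity)
  calc 1 + u * ∫ ω, ‖X ω‖ ^ 2 ∂μ
      = ∫ ω, (1 + u * ‖X ω‖ ^ 2) ∂μ := by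
        rw [integral_add (integrable_const _) (hsq.const_mul u), integral_const_mul]
        simp
    _ ≤ ∫ ω, Real.cosh (√(2 * u) * ‖X ω‖) ∂μ := by
        refine integral_mono ((integrable_const _).add (hsq.const_mul u)) (hX.integrable_cosh _)
          fun ω => le_trans (le_of_eq ?_) (one_add_sq_div_two_le_cosh _)
        rw [mul_pow, hu_sq]
        ring
    _ ≤ Real.exp ((√(2 * u) * σ) ^ 2 / 2) := hX.integral_cosh_le _
    _ = Real.exp (u * σ ^ 2) := by
        rw [mul_pow, hu_sq]
        ring_nf

end Basic

variable {Ω E : Type*} [MeasurableSpace Ω] {μ : Measure Ω} [IsProbabilityMeasure μ]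
  [NormedAddCommGroup E] [InnerProductSpace ℝ E] [CompleteSpace E] {X : Ω → E} {σ : ℝ}

lemma integral_norm_sub_integral_sq_le (hX : HasSubgaussianNorm X σ μ) :
    ∫ ω, ‖X ω - ∫ ω', X ω' ∂μ‖ ^ 2 ∂μ ≤ σ ^ 2 := by
  rw [integral_norm_sub_integral_sq hX.memLp_two]
  linarith [hX.integral_norm_sq_le, sq_nonneg ‖∫ ω, X ω ∂μ‖]

lemma norm_integral_le (hX : HasSubgaussianNorm X σ μ) : ‖∫ ω, X ω ∂μ‖ ≤ |σ| := by
  refine sq_le_sq₀ (norm_nonneg _) (abs_nonneg σ) |>.1 ?_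
  have hvar : 0 ≤ ∫ ω, ‖X ω - ∫ ω', X ω' ∂μ‖ ^ 2 ∂μ := integral_nonneg fun ω => sq_nonneg _
  rw [integral_norm_sub_integral_sq hX.memLp_two] at hvar
  rw [sq_abs]
  linarith [hX.integral_norm_sq_le]

lemma integral_exp_sub_integral_le (hX : HasSubgaussianNorm X σ μ) {c : ℝ}
    (hc : |c * σ| ≤ 1 / 3) :
    ∫ ω, (Real.exp ‖c • (X ω - ∫ ω', X ω' ∂μ)‖ - ‖c • (X ω - ∫ ω', X ω' ∂μ)‖) ∂μ ≤
      Real.exp (3 * ((c * σ) ^ 2 / 2)) := by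
  have hcX : AEStronglyMeasurable (fun ω => c • X ω) μ := hX.aestronglyMeasurable.const_smul c
  have hcosh : Integrable (fun ω => Real.cosh ‖c • X ω‖) μ := by
    simpa only [norm_smul, Real.norm_eq_abs] using hX.integrable_cosh |c|
  have hcosh_le : ∫ ω, Real.cosh ‖c • X ω‖ ∂μ ≤ Real.exp (|c * σ| ^ 2 / 2) := by
    simpa only [norm_smul, Real.norm_eq_abs, mul_pow, sq_abs] using hX.integral_cosh_le |c|
  have hone : 1 ≤ ∫ ω, Real.cosh ‖c • X ω‖ ∂μ := by
    simpa using integral_mono (integrable_const 1) hcosh fun ω => Real.one_le_cosh _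
  have hmean : ‖∫ ω, c • X ω ∂μ‖ ≤ |c * σ| := by
    rw [integral_smul, norm_smul, abs_mul, Real.norm_eq_abs]
    gcongr
    exact hX.norm_integral_le
  have hint := hX.integrable_cosh_sub_integral c
  have hmeas : AEStronglyMeasurable (fun ω => c • (X ω - ∫ ω', X ω' ∂μ)) μ :=
    (hX.aestronglyMeasurable.sub aestronglyMeasurable_const).const_smul c
  calc _ ≤ ∫ ω, (2 * Real.cosh ‖c • (X ω - ∫ ω', X ω' ∂μ)‖ - 1) ∂μ :=
        integral_mono ((integrable_exp_norm_of_integrable_cosh_norm hmeas hint).sub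
          ((memLp_two_of_integrable_cosh_norm hmeas hint).integrable one_le_two).norm)
          ((hint.const_mul 2).sub (integrable_const 1)) fun ω => exp_sub_self_le _
    _ = 2 * ∫ ω, Real.cosh ‖c • X ω - ∫ ω', c • X ω' ∂μ‖ ∂μ - 1 := by
        rw [integral_sub (hint.const_mul 2) (integrable_const 1), integral_const_mul]
        simp [smul_sub, integral_smul]
    _ ≤ 1 + 2 * (Real.exp ‖∫ ω, c • X ω ∂μ‖ * (∫ ω, Real.cosh ‖c • X ω‖ ∂μ - 1)) := by
        linarith [integral_cosh_norm_sub_integral_le hcX hcosh]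
    _ ≤ 1 + 2 * (Real.exp |c * σ| * (Real.exp (|c * σ| ^ 2 / 2) - 1)) := by
        gcongr
    _ ≤ Real.exp (3 * (|c * σ| ^ 2 / 2)) :=
        one_add_two_mul_exp_mul_le (abs_nonneg _) hc
    _ = Real.exp (3 * ((c * σ) ^ 2 / 2)) := by rw [sq_abs]

section Tail

variable [SecondCountableTopology E] [MeasurableSpace E] [BorelSpace E] {ι : Type*} [Fintype ι]
  {X : ι → Ω → E}

lemma measureReal_norm_sum_sub_integral_le_one_div
    (hX : ∀ j, HasSubgaussianNorm (X j) σ μ) (hind : iIndepFun X μ)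
    (hσ : 0 < σ) {y : ℝ} (hy : 0 < y) (hcard : 0 < Fintype.card ι) :
    μ.real {ω | σ * √(Fintype.card ι * y) ≤ ‖∑ j, (X j ω - ∫ ω', X j ω' ∂μ)‖} ≤ 1 / y := by
  set Y : ι → Ω → E := fun j ω => X j ω - ∫ ω', X j ω' ∂μ
  have hY_mem (j : ι) : MemLp (Y j) 2 μ := (hX j).memLp_two.sub (memLp_const _)
  have hY_zero (j : ι) : ∫ ω, Y j ω ∂μ = 0 := by
    simp [Y, integral_sub (hX j).integrable]
  have hY_ind : iIndepFun Y μ :=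
    hind.comp (fun j x => x - ∫ ω', X j ω' ∂μ) fun j => by fun_prop
  have hsq : ∫ ω, ‖∑ j, Y j ω‖ ^ 2 ∂μ ≤ Fintype.card ι * σ ^ 2 := by
    rw [iIndepFun_integral_norm_sum_sq hY_ind hY_mem hY_zero, ← nsmul_eq_mul]
    exact Finset.sum_le_card_nsmul _ _ _ fun j _ => (hX j).integral_norm_sub_integral_sq_le
  have hsum : Integrable (fun ω => ‖∑ j, Y j ω‖ ^ 2) μ :=
    (memLp_finsetSum Finset.univ fun j _ => hY_mem j).integrable_norm_pow two_ne_zero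
  have hmarkov := mul_meas_ge_le_integral_of_nonneg (μ := μ) (.of_forall fun ω => sq_nonneg _)
    hsum ((σ * √(Fintype.card ι * y)) ^ 2)
  simp only [sq_le_sq₀ (show 0 ≤ σ * √(Fintype.card ι * y) by positivity) (norm_nonneg _)]
    at hmarkov
  rw [mul_pow, Real.sq_sqrt (by positivity)] at hmarkov
  have : (0 : ℝ) < Fintype.card ι := Nat.cast_pos.2 hcard
  rw [le_div_iff₀ hy]
  refine le_of_mul_le_mul_left ?_ (show 0 < Fintype.card ι * σ ^ 2 by positivity)
  refine le_trans (le_of_eq ?_) (hmarkov.trans (hsq.trans_eq (mul_one _).symm))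
  ring

lemma integral_cosh_sum_sub_integral_le
    (hX : ∀ j, HasSubgaussianNorm (X j) σ μ) (hind : iIndepFun X μ)
    {c : ℝ} (hc : |c * σ| ≤ 1 / 3) :
    Integrable (fun ω => Real.cosh ‖c • ∑ j, (X j ω - ∫ ω', X j ω' ∂μ)‖) μ ∧
      ∫ ω, Real.cosh ‖c • ∑ j, (X j ω - ∫ ω', X j ω' ∂μ)‖ ∂μ ≤
        Real.exp (3 * ((c * σ) ^ 2 / 2)) ^ Fintype.card ι := by
  set Y : ι → Ω → E := fun j ω => c • (X j ω - ∫ ω', X j ω' ∂μ)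
  have hY_zero (j : ι) : ∫ ω, Y j ω ∂μ = 0 := by
    simp [Y, integral_smul, integral_sub (hX j).integrable]
  have hY_ind : iIndepFun Y μ :=
    hind.comp (fun j x => c • (x - ∫ ω', X j ω' ∂μ)) fun j => by fun_prop
  have hY_meas (j : ι) : AEStronglyMeasurable (Y j) μ :=
    ((hX j).aestronglyMeasurable.sub aestronglyMeasurable_const).const_smul c
  simp_rw [Finset.smul_sum]
  refine (iIndepFun_integral_cosh_norm_sum_le hY_ind hY_meas
    (fun j => (hX j).integrable_cosh_sub_integral c) hY_zero Finset.univ).imp_right fun h =>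
      h.trans ?_
  refine (Finset.prod_le_prod (fun j _ => integral_nonneg fun ω =>
    sub_nonneg.2 (by linarith [Real.add_one_le_exp ‖Y j ω‖]))
    fun j _ => (hX j).integral_exp_sub_integral_le hc).trans_eq ?_
  rw [Finset.prod_const, Finset.card_univ]

lemma measureReal_norm_sum_sub_integral_le_two_mul_exp
    (hX : ∀ j, HasSubgaussianNorm (X j) σ μ) (hind : iIndepFun X μ)
    (hσ : 0 < σ) {y : ℝ} (hy : 0 < y) (hcard : y ≤ Fintype.card ι) :
    μ.real {ω | σ * √(Fintype.card ι * y) ≤ ‖∑ j, (X j ω - ∫ ω', X j ω' ∂μ)‖} ≤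
      2 * Real.exp (-(y / 6)) := by
  obtain ⟨n, hn⟩ : ∃ n : ℝ, n = Fintype.card ι := ⟨_, rfl⟩
  rw [← hn] at hcard ⊢
  have hn₀ : 0 < n := hy.trans_le hcard
  -- this `c` minimises `n * (3 * ((c * σ) ^ 2 / 2)) - c * (σ * √(n * y))`
  set c := √(y / n) / (3 * σ) with hc
  have hcσ : c * σ = √(y / n) / 3 := by rw [hc]; field_simp
  have hcσ_le : |c * σ| ≤ 1 / 3 := by
    rw [hcσ, abs_of_nonneg (by positivity)]
    gcongr
    exact Real.sqrt_le_one.2 ((div_le_one hn₀).2 hcard)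
  have hcT : c * (σ * √(n * y)) = y / 3 := by
    rw [← mul_assoc, hcσ, div_mul_eq_mul_div, ← Real.sqrt_mul (by positivity),
      show y / n * (n * y) = y ^ 2 by field_simp, Real.sqrt_sq hy.le]
  obtain ⟨hint, hcosh⟩ := integral_cosh_sum_sub_integral_le hX hind hcσ_le
  have hexp : Real.exp (3 * ((c * σ) ^ 2 / 2)) ^ Fintype.card ι = Real.exp (y / 6) := by
    rw [← Real.exp_nat_mul, ← hn, hcσ, div_pow, Real.sq_sqrt (by positivity)]
    congr 1
    field_simp
    norm_num
  have hmarkov := mul_meas_ge_le_integral_of_nonneg (μ := μ)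
    (.of_forall fun ω => (Real.cosh_pos _).le) hint (Real.exp (y / 3) / 2)
  have hsubset : {ω | σ * √(n * y) ≤ ‖∑ j, (X j ω - ∫ ω', X j ω' ∂μ)‖} ⊆
      {ω | Real.exp (y / 3) / 2 ≤ Real.cosh ‖c • ∑ j, (X j ω - ∫ ω', X j ω' ∂μ)‖} := by
    intro ω hω
    have hle : y / 3 ≤ ‖c • ∑ j, (X j ω - ∫ ω', X j ω' ∂μ)‖ := by
      rw [norm_smul, Real.norm_of_nonneg (by positivity), ← hcT]
      exact mul_le_mul_of_nonneg_left hω (by positivity)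
    change Real.exp (y / 3) / 2 ≤ _
    linarith [exp_le_two_mul_cosh ‖c • ∑ j, (X j ω - ∫ ω', X j ω' ∂μ)‖, Real.exp_le_exp.2 hle]
  rw [hexp] at hcosh
  refine (measureReal_mono hsubset).trans ?_
  rw [show -(y / 6) = y / 6 - y / 3 by ring, Real.exp_sub, mul_div_assoc',
    le_div_iff₀ (Real.exp_pos _)]
  linarith

/-- For `y ≤ 16` Chebyshev's inequality suffices; for larger `y` the exponential bound takes
over. -/
theorem measureReal_norm_sum_sub_integral_le
    (hX : ∀ j, HasSubgaussianNorm (X j) σ μ) (hind : iIndepFun X μ)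
    (hσ : 0 < σ) {y : ℝ} (hy : 2 ≤ y) (hcard : y ≤ Fintype.card ι) :
    μ.real {ω | σ * √(Fintype.card ι * y) ≤ ‖∑ j, (X j ω - ∫ ω', X j ω' ∂μ)‖} ≤
      Real.exp (1 / 4 - y / 8) := by
  have hy₀ : 0 < y := two_pos.trans_le hy
  rcases le_total y 16 with hy₁₆ | hy₁₆
  · exact (measureReal_norm_sum_sub_integral_le_one_div hX hind hσ hy₀
      (Nat.cast_pos.1 (hy₀.trans_le hcard))).trans (one_div_le_exp_of_le_sixteen hy hy₁₆)
  · exact (measureReal_norm_sum_sub_integral_le_two_mul_exp hX hind hσ hy₀ hcard).trans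
      (two_mul_exp_le_of_sixteen_le hy₁₆)

end Tail

end HasSubgaussianNorm

section GeometricSeries

lemma hasSum_geometric_mul_add_one {γ : ℝ} (h0 : 0 ≤ γ) (h1 : γ < 1) :
    HasSum (fun t : ℕ => γ ^ t * (t + 1)) (1 / (1 - γ) ^ 2) := by
  simpa [mul_comm] using
    hasSum_choose_mul_geometric_of_norm_lt_one 1 ((Real.norm_of_nonneg h0).trans_lt h1)

lemma norm_sub_sum_range_le {E : Type*} [SeminormedAddCommGroup E] {f : ℕ → E} {g : ℕ → ℝ} {a : E}
    {b : ℝ} {H : ℕ} (hf : HasSum f a) (hg : HasSum g b) (hle : ∀ k, ‖f (k + H)‖ ≤ g k) :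
    ‖a - ∑ t ∈ Finset.range H, f t‖ ≤ b :=
  ((hasSum_nat_add_iff' H).2 hf).norm_le_of_bounded hg hle

lemma sqrt_le_half_div_add {x c : ℝ} (hx : 0 ≤ x) (hc : 0 < c) : √x ≤ (x / c + c) / 2 := by
  rw [div_add' _ _ _ hc.ne', div_div, le_div_iff₀ (by positivity)]
  nlinarith [sq_nonneg (√x - c), Real.sq_sqrt hx]

lemma hasSum_geometric_mul_half_div_add {γ x c : ℝ} (h0 : 0 ≤ γ) (h1 : γ < 1) (hc : c ≠ 0)
    (hcx : c ^ 2 = 1 / (1 - γ) + x) :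
    HasSum (fun k : ℕ => γ ^ k * (((k + 1 + x) / c + c) / 2)) (c / (1 - γ)) := by
  have hγ : 1 - γ ≠ 0 := (sub_pos.2 h1).ne'
  have hfun : (fun k : ℕ => γ ^ k * (((k + 1 + x) / c + c) / 2)) =
      fun k : ℕ => γ ^ k * (k + 1) * (1 / (2 * c)) + γ ^ k * ((x / c + c) / 2) := by
    ext k
    field_simp
    ring
  have hval : c / (1 - γ) =
      1 / (1 - γ) ^ 2 * (1 / (2 * c)) + (1 - γ)⁻¹ * ((x / c + c) / 2) := by
    rw [eq_sub_of_add_eq' hcx.symm]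
    field_simp
    ring
  rw [hfun, hval]
  exact ((hasSum_geometric_mul_add_one h0 h1).mul_right _).add
    ((hasSum_geometric_of_lt_one h0 h1).mul_right _)

/-- Jensen's inequality for the geometric distribution: `√` lies below its tangent at the mean
`1 / (1 - γ) + x`. -/
lemma exists_hasSum_geometric_mul_sqrt_le {γ x : ℝ} (h0 : 0 ≤ γ) (h1 : γ < 1) (hx : 0 ≤ x) :
    ∃ b ≤ √(1 / (1 - γ) + x) / (1 - γ), HasSum (fun k : ℕ => γ ^ k * √(k + 1 + x)) b := by
  have : 0 < 1 - γ := sub_pos.2 h1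
  have hmean : 0 < 1 / (1 - γ) + x := by positivity
  have hmaj := hasSum_geometric_mul_half_div_add h0 h1 (Real.sqrt_pos.2 hmean).ne'
    (Real.sq_sqrt hmean.le)
  have hle (k : ℕ) : γ ^ k * √(k + 1 + x) ≤
      γ ^ k * (((k + 1 + x) / √(1 / (1 - γ) + x) + √(1 / (1 - γ) + x)) / 2) := by
    gcongr
    exact sqrt_le_half_div_add (by positivity) (Real.sqrt_pos.2 hmean)
  have hsum : Summable fun k : ℕ => γ ^ k * √(k + 1 + x) :=
    hmaj.summable.of_nonneg_of_le (fun k => by positivity) hle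
  exact ⟨_, hasSum_le hle hsum.hasSum hmaj, hsum.hasSum⟩

lemma sum_range_geometric_mul_sqrt_le {γ : ℝ} (h0 : 0 ≤ γ) (h1 : γ < 1) (H : ℕ) :
    ∑ t ∈ Finset.range H, γ ^ t * √(t + 1) ≤ 1 / (1 - γ) ^ (3 / 2 : ℝ) := by
  have hγ : 0 < 1 - γ := sub_pos.2 h1
  have hpow : (1 - γ) ^ (3 / 2 : ℝ) = (1 - γ) * √(1 - γ) := by
    rw [Real.sqrt_eq_rpow, show (3 / 2 : ℝ) = 1 + 1 / 2 by norm_num, Real.rpow_add hγ,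
      Real.rpow_one]
  obtain ⟨b, hb, hsum⟩ := exists_hasSum_geometric_mul_sqrt_le h0 h1 le_rfl
  simp only [add_zero] at hb hsum
  refine (sum_le_hasSum _ (fun t _ => by positivity) hsum).trans (hb.trans_eq ?_)
  rw [hpow, Real.sqrt_div zero_le_one, Real.sqrt_one, div_div, mul_comm]

end GeometricSeries

section SampleMean

variable {X E ι : Type*} [Fintype ι]

/-- The empirical mean of `f` over a finite sample `x`. -/
noncomputable def sampleMean [AddCommMonoid E] [Module ℝ E] (f : X → E) (x : ι → X) : E :=
  (1 / (Fintype.card ι : ℝ)) • ∑ j, f (x j)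

lemma sampleMean_sub_const [Nonempty ι] [AddCommGroup E] [Module ℝ E] (f : X → E) (x : ι → X)
    (a : E) :
    sampleMean f x - a = (1 / (Fintype.card ι : ℝ)) • ∑ j, (f (x j) - a) := by
  simp [sampleMean, Finset.sum_sub_distrib, smul_sub, ← Nat.cast_smul_eq_nsmul ℝ, smul_smul]

variable {Ω : Type*} [MeasurableSpace X] [MeasurableSpace Ω] {P : Measure X} {Pr : Measure Ω}
  {τ : ι → Ω → X} [NormedAddCommGroup E]

lemma integrable_comp_of_hasLaw {f : X → E} (hf : Integrable f P) {τ : Ω → X}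
    (hτ : HasLaw τ P Pr) : Integrable (fun ω => f (τ ω)) Pr := by
  obtain ⟨hmeas, rfl⟩ := hτ
  exact hf.comp_aemeasurable hmeas

variable [NormedSpace ℝ E]

lemma integrable_sampleMean {f : X → E} (hf : Integrable f P) (hτ : ∀ j, HasLaw (τ j) P Pr) :
    Integrable (fun ω => sampleMean f fun j => τ j ω) Pr :=
  (integrable_finsetSum _ fun j _ => integrable_comp_of_hasLaw hf (hτ j)).fun_smul _

lemma integral_sampleMean [Nonempty ι] {f : X → E} (hf : Integrable f P)
    (hτ : ∀ j, HasLaw (τ j) P Pr) :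
    ∫ ω, sampleMean f (fun j => τ j ω) ∂Pr = ∫ x, f x ∂P := by
  have hterm (j : ι) : ∫ ω, f (τ j ω) ∂Pr = ∫ x, f x ∂P :=
    (hτ j).integral_comp hf.aestronglyMeasurable
  simp only [sampleMean]
  rw [integral_smul, integral_finsetSum _ fun j _ => integrable_comp_of_hasLaw hf (hτ j)]
  simp [hterm, ← Nat.cast_smul_eq_nsmul ℝ, smul_smul]

end SampleMean

section Concentration

variable {Ω : Type*} [MeasurableSpace Ω] {Pr : Measure Ω}

lemma one_sub_le_measureReal [IsProbabilityMeasure Pr] {s t : Set Ω} {δ : ℝ}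
    (ht : Pr.real t ≤ δ) (hst : sᶜ ⊆ t) : 1 - δ ≤ Pr.real s := by
  have hunion : s ∪ t = Set.univ := Set.compl_subset_iff_union.1 hst
  have hle := measureReal_union_le (μ := Pr) s t
  rw [hunion, probReal_univ] at hle
  linarith

lemma measureReal_le_abs_le_of_hasSubgaussianMGF {Y : Ω → ℝ} {c : NNReal}
    (hY : HasSubgaussianMGF Y c Pr) {ε : ℝ} (hε : 0 ≤ ε) :
    Pr.real {ω | ε ≤ |Y ω|} ≤ 2 * Real.exp (-ε ^ 2 / (2 * c)) := by
  simp only [le_abs, Set.ofPred_or]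
  refine (measureReal_union_le _ _).trans ?_
  rw [two_mul]
  exact add_le_add (hY.measure_ge_le hε) (hY.neg.measure_ge_le hε)

lemma one_sub_le_measureReal_abs_le_of_hasSubgaussianMGF [IsProbabilityMeasure Pr] {Y : Ω → ℝ}
    {c : NNReal} (hY : HasSubgaussianMGF Y c Pr) (hc : 0 < c) {δ : ℝ} (hδ : 0 < δ) (hδ2 : δ ≤ 2) :
    1 - δ ≤ Pr.real {ω | |Y ω| ≤ √(2 * c * Real.log (2 / δ))} := by
  have hlog : 0 ≤ Real.log (2 / δ) := Real.log_nonneg ((one_le_div hδ).2 hδ2)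
  have : (0 : ℝ) < c := hc
  refine one_sub_le_measureReal ((measureReal_le_abs_le_of_hasSubgaussianMGF hY
    (Real.sqrt_nonneg _)).trans_eq ?_) fun ω (hω : ¬ |Y ω| ≤ _) => (not_le.1 hω).le
  rw [Real.sq_sqrt (by positivity), neg_div, mul_div_cancel_left₀ _ (by positivity), Real.exp_neg,
    Real.exp_log (by positivity)]
  field_simp

variable {X ι : Type*} [Fintype ι] [Nonempty ι] [MeasurableSpace X] {P : Measure X}
  {τ : ι → Ω → X} [IsProbabilityMeasure Pr]

lemma hasSubgaussianMGF_sampleMean_sub_integral {f : X → ℝ} {B : NNReal} (hf : Measurable f)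
    (hB : ∀ x, |f x| ≤ B) (hind : iIndepFun τ Pr) (hτ : ∀ j, HasLaw (τ j) P Pr) :
    HasSubgaussianMGF (fun ω => sampleMean f (fun j => τ j ω) - ∫ x, f x ∂P)
      (B ^ 2 / Fintype.card ι) Pr := by
  have hterm (j : ι) : HasSubgaussianMGF (fun ω => f (τ j ω) - ∫ x, f x ∂P) (B ^ 2) Pr := by
    have hoeffding := hasSubgaussianMGF_of_mem_Icc (hf.comp_aemeasurable (hτ j).aemeasurable)
      (.of_forall fun ω => abs_le.1 (hB (τ j ω)))
    have hwidth : (‖(B : ℝ) - -B‖₊ / 2) ^ 2 = B ^ 2 := by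
      rw [sub_neg_eq_add, ← NNReal.coe_add, NNReal.nnnorm_eq, add_self_div_two]
    rw [hwidth] at hoeffding
    exact (hτ j).integral_comp hf.aestronglyMeasurable ▸ hoeffding
  have hsum := (HasSubgaussianMGF.sum_of_iIndepFun (hind.comp (fun _ x => f x - ∫ x, f x ∂P)
    fun _ => hf.sub_const _) (s := Finset.univ) fun j _ => hterm j).const_mul
      (1 / (Fintype.card ι : ℝ))
  simp only [sampleMean_sub_const, smul_eq_mul]
  convert hsum using 1
  · rfl
  · refine NNReal.eq ?_
    change _ = (1 / (Fintype.card ι : ℝ)) ^ 2 * ((∑ _i : ι, B ^ 2 : NNReal) : ℝ)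
    simp only [NNReal.coe_div, NNReal.coe_pow, NNReal.coe_natCast, Finset.sum_const,
      Finset.card_univ, nsmul_eq_mul, NNReal.coe_mul]
    field_simp

lemma one_sub_le_measureReal_norm_sampleMean_sub_integral_le {E : Type*} [NormedAddCommGroup E]
    [InnerProductSpace ℝ E] [CompleteSpace E] [SecondCountableTopology E] [MeasurableSpace E]
    [BorelSpace E]
    {f : X → E} {σ : ℝ} (hf : Measurable f) (hσ : 0 < σ) (hfσ : HasSubgaussianNorm f σ P)
    (hind : iIndepFun τ Pr) (hτ : ∀ j, HasLaw (τ j) P Pr) {δ : ℝ} (hδ : 0 < δ) (hδ1 : δ ≤ 1)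
    (hcard : 8 * Real.log (Real.exp (1 / 4) / δ) ≤ Fintype.card ι) :
    1 - δ ≤ Pr.real {ω | ‖sampleMean f (fun j => τ j ω) - ∫ x, f x ∂P‖ ≤
      σ * √(8 * Real.log (Real.exp (1 / 4) / δ) / Fintype.card ι)} := by
  set n : ℝ := (Fintype.card ι : ℝ) with hn
  set y : ℝ := 8 * Real.log (Real.exp (1 / 4) / δ) with hy
  have hlog : y = 8 * (1 / 4 - Real.log δ) := by
    rw [hy, Real.log_div (Real.exp_pos _).ne' hδ.ne', Real.log_exp]
  have hn₀ : 0 < n := Nat.cast_pos.2 Fintype.card_pos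
  have hmean (j : ι) : ∫ ω, f (τ j ω) ∂Pr = ∫ x, f x ∂P :=
    (hτ j).integral_comp hf.aestronglyMeasurable
  have hscale : σ * √(n * y) = n * (σ * √(y / n)) := by
    rw [show n * y = n ^ 2 * (y / n) by field_simp, Real.sqrt_mul (sq_nonneg n),
      Real.sqrt_sq hn₀.le]
    ring
  have htail := HasSubgaussianNorm.measureReal_norm_sum_sub_integral_le
    (fun j => (HasSubgaussianNorm.comp_hasLaw_iff (hτ j) hf.aestronglyMeasurable).2 hfσ)
    (hind.comp (fun _ => f) fun _ => hf) hσ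
    (by linarith [Real.log_nonpos hδ.le hδ1] : 2 ≤ y) hcard
  simp only [Function.comp_apply, hmean, ← hn, hscale] at htail
  have hexp : Real.exp (1 / 4 - y / 8) = δ := by
    rw [hlog, mul_div_cancel_left₀ _ (by norm_num), sub_sub_cancel, Real.exp_log hδ]
  refine one_sub_le_measureReal (htail.trans_eq hexp) fun ω hω => ?_
  have hlt : σ * √(y / n) < ‖sampleMean f (fun j => τ j ω) - ∫ x, f x ∂P‖ := not_le.1 hω
  rw [sampleMean_sub_const, norm_smul, Real.norm_of_nonneg (by positivity), ← hn,
    one_div_mul_eq_div, lt_div_iff₀' hn₀] at hlt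
  exact hlt.le

end Concentration

section MarkovChain

variable {X : Type*} [MeasurableSpace X]

/-- The law of a time-homogeneous Markov chain with initial law `μ₀` and transition kernel `κ`. -/
noncomputable def markovChainLaw (μ₀ : Measure X) (κ : Kernel X X) [IsMarkovKernel κ] :
    Measure (ℕ → X) :=
  Kernel.trajMeasure (X := fun _ => X) μ₀ fun t =>
    κ.comap (fun x : (_ : Finset.Iic t) → X => x ⟨t, Finset.mem_Iic.2 le_rfl⟩)
      (measurable_pi_apply _)

instance isProbabilityMeasure_markovChainLaw (μ₀ : Measure X) [IsProbabilityMeasure μ₀]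
    (κ : Kernel X X) [IsMarkovKernel κ] : IsProbabilityMeasure (markovChainLaw μ₀ κ) := by
  unfold markovChainLaw
  infer_instance

/-- The trajectory that follows the history `p.1` up to time `t` and stays at `p.2` afterwards. It
turns a functional of trajectories into one of histories. -/
def extendHistory (t : ℕ) (p : ((_ : Finset.Iic t) → X) × X) : ℕ → X := fun k =>
  if h : k ≤ t then p.1 ⟨k, Finset.mem_Iic.2 h⟩ else p.2

lemma measurable_extendHistory (t : ℕ) : Measurable (extendHistory (X := X) t) := by
  refine measurable_pi_iff.2 fun k => ?_
  by_cases h : k ≤ t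
  · simp only [extendHistory, h, dite_true]
    fun_prop
  · simp only [extendHistory, h, dite_false]
    fun_prop

end MarkovChain

section DependsOn

variable {X β : Type*} {t : ℕ}

lemma dependsOn_Iic_extendHistory {F : (ℕ → X) → β} (hF : DependsOn F (Set.Iic t))
    (τ : ℕ → X) (x : X) : F (extendHistory t (Preorder.frestrictLe t τ, x)) = F τ :=
  hF fun k hk => by simp [extendHistory, Set.mem_Iic.1 hk]

lemma dependsOn_Iic_succ_extendHistory {F : (ℕ → X) → β}
    (hF : DependsOn F (Set.Iic (t + 1))) (τ : ℕ → X) (x : X) :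
    F (extendHistory t (Preorder.frestrictLe t τ, x)) = F (Function.update τ (t + 1) x) := by
  refine hF fun k hk => ?_
  rcases (Set.mem_Iic.1 hk).lt_or_eq with hlt | rfl
  · simp [extendHistory, Nat.lt_succ_iff.1 hlt, Function.update_of_ne hlt.ne]
  · simp [extendHistory]

@[to_additive]
lemma dependsOn_Iic_prod_range_succ {M : Type*} [CommMonoid M] (w : X → M) (t : ℕ) :
    DependsOn (fun τ : ℕ → X => ∏ k ∈ Finset.range (t + 1), w (τ k)) (Set.Iic t) :=
  fun _ _ h => Finset.prod_congr rfl fun k hk => by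
    rw [h k (Set.mem_Iic.2 (Nat.lt_succ_iff.1 (Finset.mem_range.1 hk)))]

@[to_additive]
lemma prod_range_succ_update {M : Type*} [CommMonoid M] (w : X → M) (t : ℕ) (τ : ℕ → X) (x : X) :
    ∏ k ∈ Finset.range (t + 1 + 1), w (Function.update τ (t + 1) x k) =
      (∏ k ∈ Finset.range (t + 1), w (τ k)) * w x := by
  rw [Finset.prod_range_succ, Function.update_self]
  congr 1
  exact Finset.prod_congr rfl fun k hk => by
    rw [Function.update_of_ne (Finset.mem_range.1 hk).ne]

lemma dependsOn_Iic_lintegral_update [MeasurableSpace X] {F : (ℕ → X) → ℝ≥0∞}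
    (hF : DependsOn F (Set.Iic (t + 1))) (κ : Kernel X X) :
    DependsOn (fun τ : ℕ → X => ∫⁻ x, F (Function.update τ (t + 1) x) ∂κ (τ t))
      (Set.Iic t) := by
  intro τ τ' h
  simp only
  rw [h t (Set.mem_Iic.2 le_rfl)]
  refine lintegral_congr fun x => hF fun k hk => ?_
  rcases (Set.mem_Iic.1 hk).lt_or_eq with hlt | rfl
  · rw [Function.update_of_ne hlt.ne, Function.update_of_ne hlt.ne]
    exact h k (Set.mem_Iic.2 (Nat.lt_succ_iff.1 hlt))
  · simp

end DependsOn

section MarkovChain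

variable {X : Type*} [MeasurableSpace X] {t : ℕ}

lemma measurable_lintegral_update {F : (ℕ → X) → ℝ≥0∞} (hF : Measurable F) (t : ℕ)
    (κ : Kernel X X) [IsSFiniteKernel κ] :
    Measurable fun τ : ℕ → X => ∫⁻ x, F (Function.update τ (t + 1) x) ∂κ (τ t) :=
  have hF_update : Measurable fun p : (ℕ → X) × X => F (Function.update p.1 (t + 1) p.2) :=
    hF.comp measurable_update'
  hF_update.lintegral_kernel_prod_right' (κ := κ.comap (fun τ : ℕ → X => τ t) (by fun_prop))

variable (μ₀ : Measure X) (κ : Kernel X X) [IsMarkovKernel κ]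

lemma map_eval_zero_markovChainLaw : (markovChainLaw μ₀ κ).map (fun τ => τ 0) = μ₀ := by
  have hcomp : (fun τ : ℕ → X => τ 0) =
      (fun x : (_ : Finset.Iic 0) → X => x ⟨0, Finset.mem_Iic.2 le_rfl⟩) ∘
        (Preorder.frestrictLe (π := fun _ => X) 0) := rfl
  rw [hcomp, ← Measure.map_map (by fun_prop) (by fun_prop), markovChainLaw, Kernel.trajMeasure,
    Measure.map_comp _ _ (by fun_prop), Kernel.traj_map_frestrictLe, Kernel.partialTraj_self,
    Measure.id_comp, Measure.map_map (by fun_prop) (by fun_prop)]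
  exact Measure.map_id

variable [IsProbabilityMeasure μ₀]

lemma map_frestrictLe_succ_markovChainLaw (t : ℕ) :
    (markovChainLaw μ₀ κ).map
        (fun τ => (Preorder.frestrictLe (π := fun _ => X) t τ, τ (t + 1))) =
      (markovChainLaw μ₀ κ).map (Preorder.frestrictLe (π := fun _ => X) t) ⊗ₘ
        (κ.comap (fun x : (_ : Finset.Iic t) → X => x ⟨t, Finset.mem_Iic.2 le_rfl⟩)
          (measurable_pi_apply _)) :=
  Kernel.map_frestrictLe_trajMeasure_compProd_eq_map_trajMeasure.symm

lemma lintegral_markovChainLaw_succ {F : (ℕ → X) → ℝ≥0∞} (hF : Measurable F)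
    (hFt : DependsOn F (Set.Iic (t + 1))) :
    ∫⁻ τ, F τ ∂markovChainLaw μ₀ κ =
      ∫⁻ τ, ∫⁻ x, F (Function.update τ (t + 1) x) ∂κ (τ t) ∂markovChainLaw μ₀ κ := by
  have hmeas := hF.comp (measurable_extendHistory t)
  calc ∫⁻ τ, F τ ∂markovChainLaw μ₀ κ
      = ∫⁻ p, (F ∘ extendHistory t) p ∂(markovChainLaw μ₀ κ).map
          (fun τ => (Preorder.frestrictLe (π := fun _ => X) t τ, τ (t + 1))) := by
        rw [lintegral_map hmeas (by fun_prop)]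
        simp_rw [Function.comp_apply, dependsOn_Iic_succ_extendHistory hFt,
          Function.update_eq_self]
    _ = _ := by
        rw [map_frestrictLe_succ_markovChainLaw, Measure.lintegral_compProd hmeas,
          lintegral_map hmeas.lintegral_kernel_prod_right' (by fun_prop)]
        simp_rw [Function.comp_apply, dependsOn_Iic_succ_extendHistory hFt]
        rfl

variable {E : Type*} [NormedAddCommGroup E] [NormedSpace ℝ E]

lemma integral_markovChainLaw_succ {F : (ℕ → X) → E} (hF : StronglyMeasurable F)
    (hF_int : Integrable F (markovChainLaw μ₀ κ)) (hFt : DependsOn F (Set.Iic (t + 1))) :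
    ∫ τ, F τ ∂markovChainLaw μ₀ κ =
      ∫ τ, ∫ x, F (Function.update τ (t + 1) x) ∂κ (τ t) ∂markovChainLaw μ₀ κ := by
  have hmeas := hF.comp_measurable (measurable_extendHistory t)
  have hmap : Measurable fun τ : ℕ → X =>
    (Preorder.frestrictLe (π := fun _ => X) t τ, τ (t + 1)) := by fun_prop
  have hcomp (τ : ℕ → X) :
      F (extendHistory t (Preorder.frestrictLe t τ, τ (t + 1))) = F τ := by
    rw [dependsOn_Iic_succ_extendHistory hFt, Function.update_eq_self]
  have hint : Integrable (F ∘ extendHistory t) ((markovChainLaw μ₀ κ).map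
      (fun τ => (Preorder.frestrictLe (π := fun _ => X) t τ, τ (t + 1)))) :=
    (integrable_map_measure hmeas.aestronglyMeasurable hmap.aemeasurable).2
      (by simpa only [Function.comp_def, hcomp] using hF_int)
  calc ∫ τ, F τ ∂markovChainLaw μ₀ κ
      = ∫ p, (F ∘ extendHistory t) p ∂(markovChainLaw μ₀ κ).map
          (fun τ => (Preorder.frestrictLe (π := fun _ => X) t τ, τ (t + 1))) := by
        rw [integral_map hmap.aemeasurable hint.1]
        simp_rw [Function.comp_apply, hcomp]
    _ = _ := by
        rw [map_frestrictLe_succ_markovChainLaw] at hint ⊢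
        rw [Measure.integral_compProd hint, integral_map (by fun_prop)
          hmeas.integral_kernel_prod_right'.aestronglyMeasurable]
        simp_rw [Function.comp_apply, dependsOn_Iic_succ_extendHistory hFt]
        rfl

section LikelihoodRatio

variable {μ₀ κ} {μ₀' : Measure X} [IsProbabilityMeasure μ₀'] {κ' : Kernel X X}
  [IsMarkovKernel κ'] {w : X → ℝ≥0∞}

lemma lintegral_markovChainLaw_eq_lintegral_prod_mul (hw : Measurable w)
    (hμ₀ : μ₀' = μ₀.withDensity w) (hκ : ∀ x, κ' x = (κ x).withDensity w) (t : ℕ)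
    {F : (ℕ → X) → ℝ≥0∞} (hF : Measurable F) (hFt : DependsOn F (Set.Iic t)) :
    ∫⁻ τ, F τ ∂markovChainLaw μ₀' κ' =
      ∫⁻ τ, (∏ k ∈ Finset.range (t + 1), w (τ k)) * F τ ∂markovChainLaw μ₀ κ := by
  induction t generalizing F with
  | zero =>
    obtain ⟨f, hf, rfl⟩ : ∃ f : X → ℝ≥0∞, Measurable f ∧ F = fun τ => f (τ 0) :=
      ⟨fun x => F fun _ => x, hF.comp (measurable_pi_iff.2 fun _ => measurable_id),
        funext fun τ => hFt fun k hk => by rw [Nat.le_zero.1 hk]⟩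
    have hzero (μ : Measure X) (η : Kernel X X) [IsMarkovKernel η]
        {g : X → ℝ≥0∞} (hg : Measurable g) :
        ∫⁻ τ, g (τ 0) ∂markovChainLaw μ η = ∫⁻ x, g x ∂μ := by
      conv_rhs => rw [← map_eval_zero_markovChainLaw μ η, lintegral_map hg (by fun_prop)]
    simp only [zero_add, Finset.range_one, Finset.prod_singleton]
    rw [hzero μ₀' κ' hf, hμ₀, lintegral_withDensity_eq_lintegral_mul _ hw hf]
    exact (hzero μ₀ κ (hw.mul hf)).symm
  | succ t ih =>
    have hprod_mul : Measurable fun τ : ℕ → X =>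
        (∏ k ∈ Finset.range (t + 1 + 1), w (τ k)) * F τ := by fun_prop
    rw [lintegral_markovChainLaw_succ μ₀' κ' hF hFt,
      ih (measurable_lintegral_update hF t κ') (dependsOn_Iic_lintegral_update hFt κ'),
      lintegral_markovChainLaw_succ μ₀ κ (t := t) hprod_mul]
    · refine lintegral_congr fun τ => ?_
      have hFτ : Measurable fun x => F (Function.update τ (t + 1) x) :=
        hF.comp (measurable_update τ)
      simp_rw [prod_range_succ_update, hκ]
      rw [lintegral_withDensity_eq_lintegral_mul _ hw hFτ, ← lintegral_const_mul _ (hw.mul hFτ)]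
      simp only [Pi.mul_apply, mul_assoc]
    · exact fun τ τ' h =>
        congrArg₂ (· * ·) (dependsOn_Iic_prod_range_succ w (t + 1) h) (hFt h)

lemma map_frestrictLe_markovChainLaw_eq_map_withDensity (hw : Measurable w)
    (hμ₀ : μ₀' = μ₀.withDensity w) (hκ : ∀ x, κ' x = (κ x).withDensity w) (t : ℕ) :
    (markovChainLaw μ₀' κ').map (Preorder.frestrictLe (π := fun _ => X) t) =
      ((markovChainLaw μ₀ κ).withDensity fun τ => ∏ k ∈ Finset.range (t + 1), w (τ k)).map
        (Preorder.frestrictLe t) := by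
  ext s hs
  have hmeas : MeasurableSet (Preorder.frestrictLe (π := fun _ => X) t ⁻¹' s) :=
    Preorder.measurable_frestrictLe t hs
  rw [Measure.map_apply (by fun_prop) hs, Measure.map_apply (by fun_prop) hs,
    withDensity_apply _ hmeas, ← lintegral_indicator_one hmeas, ← lintegral_indicator hmeas,
    lintegral_markovChainLaw_eq_lintegral_prod_mul hw hμ₀ hκ t (measurable_one.indicator hmeas)]
  · refine lintegral_congr fun τ => ?_
    by_cases h : τ ∈ Preorder.frestrictLe (π := fun _ => X) t ⁻¹' s <;> simp [h]
  · intro τ τ' h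
    have hrestrict : Preorder.frestrictLe (π := fun _ => X) t τ = Preorder.frestrictLe t τ' := by
      ext k : 1
      exact h k (Set.mem_Iic.2 (Finset.mem_Iic.1 k.2))
    have hiff : τ ∈ Preorder.frestrictLe (π := fun _ => X) t ⁻¹' s ↔
        τ' ∈ Preorder.frestrictLe (π := fun _ => X) t ⁻¹' s := by
      rw [Set.mem_preimage, Set.mem_preimage, hrestrict]
    by_cases h' : τ' ∈ Preorder.frestrictLe (π := fun _ => X) t ⁻¹' s <;>
      simp [Set.indicator, hiff, h']

lemma integral_markovChainLaw_eq_integral_prod_smul (hw : Measurable w) (hw_top : ∀ x, w x ≠ ∞)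
    (hμ₀ : μ₀' = μ₀.withDensity w) (hκ : ∀ x, κ' x = (κ x).withDensity w) (t : ℕ)
    {F : (ℕ → X) → E} (hF : StronglyMeasurable F) (hFt : DependsOn F (Set.Iic t)) :
    ∫ τ, F τ ∂markovChainLaw μ₀' κ' =
      ∫ τ, (∏ k ∈ Finset.range (t + 1), (w (τ k)).toReal) • F τ ∂markovChainLaw μ₀ κ := by
  obtain ⟨x₀⟩ : Nonempty X := nonempty_of_isProbabilityMeasure μ₀
  let G : ((_ : Finset.Iic t) → X) → E := fun h => F (extendHistory t (h, x₀))
  have hG : StronglyMeasurable G := hF.comp_measurable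
    ((measurable_extendHistory t).comp (measurable_id.prodMk measurable_const))
  have hmap (P : Measure (ℕ → X)) :
      ∫ τ, F τ ∂P = ∫ h, G h ∂P.map (Preorder.frestrictLe t) := by
    rw [integral_map (by fun_prop) hG.aestronglyMeasurable]
    simp only [G, dependsOn_Iic_extendHistory hFt]
  rw [hmap, map_frestrictLe_markovChainLaw_eq_map_withDensity hw hμ₀ hκ, ← hmap,
    integral_withDensity_eq_integral_toReal_smul (by fun_prop) (.of_forall fun τ =>
      ENNReal.prod_lt_top fun k _ => (hw_top _).lt_top)]
  simp only [ENNReal.toReal_prod]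

end LikelihoodRatio

end MarkovChain

section CentredIncrements

variable {Ω E : Type*} [MeasurableSpace Ω] [NormedAddCommGroup E] [InnerProductSpace ℝ E]
  [CompleteSpace E] {μ : Measure Ω} [IsProbabilityMeasure μ] {Y : Ω → E} {b : ℝ}

lemma integral_cosh_norm_add_le_mul_cosh (hY : AEStronglyMeasurable Y μ)
    (hY_le : ∀ ω, ‖Y ω‖ ≤ b) (hY_zero : ∫ ω, Y ω ∂μ = 0) (z : E) :
    ∫ ω, Real.cosh ‖z + Y ω‖ ∂μ ≤ Real.cosh b * Real.cosh ‖z‖ := by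
  have hint : Integrable Y μ := .of_bound hY b (.of_forall hY_le)
  have hinner : Integrable (fun ω => Real.sinh b / b * ⟪coshNormGrad z, Y ω⟫) μ :=
    (hint.const_inner (𝕜 := ℝ) _).const_mul _
  refine (integral_mono_of_nonneg (.of_forall fun ω => (Real.cosh_pos _).le)
    ((integrable_const _).add hinner)
    (.of_forall fun ω => cosh_norm_add_le z (hY_le ω))).trans_eq ?_
  simp only [Pi.add_apply]
  rw [integral_add (integrable_const _) hinner, integral_const_mul (Real.sinh b / b),
    integral_inner hint, hY_zero]
  simp [mul_comm]

lemma integral_norm_add_sq_le_add_sq (hY : AEStronglyMeasurable Y μ)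
    (hY_le : ∀ ω, ‖Y ω‖ ≤ b) (hY_zero : ∫ ω, Y ω ∂μ = 0) (z : E) :
    ∫ ω, ‖z + Y ω‖ ^ 2 ∂μ ≤ ‖z‖ ^ 2 + b ^ 2 := by
  have hint : Integrable Y μ := .of_bound hY b (.of_forall hY_le)
  have hinner : Integrable (fun ω => 2 * ⟪z, Y ω⟫) μ :=
    (hint.const_inner (𝕜 := ℝ) z).const_mul 2
  have hle (ω : Ω) : ‖z + Y ω‖ ^ 2 ≤ ‖z‖ ^ 2 + b ^ 2 + 2 * ⟪z, Y ω⟫ := by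
    have hsq := pow_le_pow_left₀ (norm_nonneg _) (hY_le ω) 2
    rw [norm_add_sq_real]
    linarith
  refine (integral_mono_of_nonneg (.of_forall fun ω => sq_nonneg _)
    ((integrable_const _).add hinner) (.of_forall hle)).trans_eq ?_
  simp only [Pi.add_apply]
  rw [integral_add (integrable_const _) hinner, integral_const_mul, integral_inner hint, hY_zero]
  simp

end CentredIncrements

section AdditiveFunctionals

lemma norm_sum_range_le_of_norm_le {E : Type*} [SeminormedAddCommGroup E] {y : ℕ → E} {b : ℝ}
    (hy : ∀ k, ‖y k‖ ≤ b) (t : ℕ) : ‖∑ k ∈ Finset.range (t + 1), y k‖ ≤ (t + 1) * b :=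
  (norm_sum_le_of_le _ fun k _ => hy k).trans_eq (by simp)

variable {X E : Type*} [MeasurableSpace X] [NormedAddCommGroup E]
  {μ₀ : Measure X} {κ : Kernel X X} [IsMarkovKernel κ]
  {Y : X → E} {b : ℝ}

lemma integral_comp_sum_range_one_markovChainLaw {Φ : E → ℝ} (hΦ : Continuous Φ)
    (hY : StronglyMeasurable Y) :
    ∫ τ, Φ (∑ k ∈ Finset.range (0 + 1), Y (τ k)) ∂markovChainLaw μ₀ κ = ∫ y, Φ (0 + Y y) ∂μ₀ := by
  simp only [zero_add, Finset.range_one, Finset.sum_singleton]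
  conv_rhs => rw [← map_eval_zero_markovChainLaw μ₀ κ]
  rw [integral_map (measurable_pi_apply 0).aemeasurable
    (hΦ.comp_stronglyMeasurable hY).aestronglyMeasurable]

variable [IsProbabilityMeasure μ₀]

lemma integral_comp_sum_markovChainLaw_succ_le {Φ : E → ℝ} (hΦ : Continuous Φ)
    (hΦ_nonneg : ∀ z, 0 ≤ Φ z) (hY : StronglyMeasurable Y)
    (hΦ_int : ∀ t : ℕ, Integrable (fun τ => Φ (∑ k ∈ Finset.range (t + 1), Y (τ k)))
      (markovChainLaw μ₀ κ))
    {a c : ℝ} (hstep : ∀ x z, ∫ y, Φ (z + Y y) ∂κ x ≤ a * Φ z + c) (t : ℕ) :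
    ∫ τ, Φ (∑ k ∈ Finset.range (t + 1 + 1), Y (τ k)) ∂markovChainLaw μ₀ κ ≤
      a * ∫ τ, Φ (∑ k ∈ Finset.range (t + 1), Y (τ k)) ∂markovChainLaw μ₀ κ + c := by
  have hmeas : StronglyMeasurable fun τ : ℕ → X =>
      Φ (∑ k ∈ Finset.range (t + 1 + 1), Y (τ k)) :=
    hΦ.comp_stronglyMeasurable (Finset.stronglyMeasurable_fun_sum _ fun k _ =>
      hY.comp_measurable (measurable_pi_apply k))
  rw [integral_markovChainLaw_succ μ₀ κ (t := t) hmeas (hΦ_int (t + 1)) fun τ τ' h =>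
    congrArg Φ (dependsOn_Iic_sum_range_succ Y (t + 1) h)]
  simp_rw [sum_range_succ_update]
  refine (integral_mono_of_nonneg (.of_forall fun τ => integral_nonneg fun y => hΦ_nonneg _)
    (((hΦ_int t).const_mul a).add (integrable_const c))
    (.of_forall fun τ => hstep (τ t) _)).trans_eq ?_
  simp only [Pi.add_apply]
  rw [integral_add ((hΦ_int t).const_mul a) (integrable_const c), integral_const_mul]
  simp

variable [InnerProductSpace ℝ E] [CompleteSpace E]

lemma integral_cosh_norm_sum_markovChainLaw_le (hY : StronglyMeasurable Y)
    (hY_le : ∀ x, ‖Y x‖ ≤ b) (hμ₀ : ∫ y, Y y ∂μ₀ = 0) (hκ : ∀ x, ∫ y, Y y ∂κ x = 0) (t : ℕ) :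
    ∫ τ, Real.cosh ‖∑ k ∈ Finset.range (t + 1), Y (τ k)‖ ∂markovChainLaw μ₀ κ ≤
      Real.cosh b ^ (t + 1) := by
  have hΦ : Continuous fun z : E => Real.cosh ‖z‖ := Real.continuous_cosh.comp continuous_norm
  have hint (t : ℕ) : Integrable (fun τ => Real.cosh ‖∑ k ∈ Finset.range (t + 1), Y (τ k)‖)
      (markovChainLaw μ₀ κ) := by
    refine .of_bound (hΦ.comp_stronglyMeasurable (Finset.stronglyMeasurable_fun_sum _ fun k _ =>
      hY.comp_measurable (measurable_pi_apply k))).aestronglyMeasurable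
      (Real.cosh ((t + 1) * b)) (.of_forall fun τ => ?_)
    have hle := norm_sum_range_le_of_norm_le (fun k => hY_le (τ k)) t
    rw [Real.norm_of_nonneg (Real.cosh_pos _).le, Real.cosh_le_cosh, abs_of_nonneg (norm_nonneg _)]
    exact hle.trans (le_abs_self _)
  induction t with
  | zero =>
    rw [integral_comp_sum_range_one_markovChainLaw hΦ hY]
    simpa using integral_cosh_norm_add_le_mul_cosh hY.aestronglyMeasurable hY_le hμ₀ 0
  | succ t ih =>
    refine (integral_comp_sum_markovChainLaw_succ_le hΦ (fun z => (Real.cosh_pos _).le) hY hint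
      (a := Real.cosh b) (c := 0) (fun x z => ?_) t).trans ?_
    · rw [add_zero]
      exact integral_cosh_norm_add_le_mul_cosh hY.aestronglyMeasurable hY_le (hκ x) z
    · rw [add_zero, pow_succ' _ (t + 1)]
      exact mul_le_mul_of_nonneg_left ih (Real.cosh_pos b).le

lemma integral_norm_sum_sq_markovChainLaw_le (hY : StronglyMeasurable Y)
    (hY_le : ∀ x, ‖Y x‖ ≤ b) (hμ₀ : ∫ y, Y y ∂μ₀ = 0) (hκ : ∀ x, ∫ y, Y y ∂κ x = 0) (t : ℕ) :
    ∫ τ, ‖∑ k ∈ Finset.range (t + 1), Y (τ k)‖ ^ 2 ∂markovChainLaw μ₀ κ ≤ (t + 1) * b ^ 2 := by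
  have hΦ : Continuous fun z : E => ‖z‖ ^ 2 := continuous_norm.pow 2
  have hint (t : ℕ) : Integrable (fun τ => ‖∑ k ∈ Finset.range (t + 1), Y (τ k)‖ ^ 2)
      (markovChainLaw μ₀ κ) := by
    refine .of_bound (hΦ.comp_stronglyMeasurable (Finset.stronglyMeasurable_fun_sum _ fun k _ =>
      hY.comp_measurable (measurable_pi_apply k))).aestronglyMeasurable
      (((t + 1) * b) ^ 2) (.of_forall fun τ => ?_)
    rw [Real.norm_of_nonneg (sq_nonneg _)]
    exact pow_le_pow_left₀ (norm_nonneg _) (norm_sum_range_le_of_norm_le (fun k => hY_le (τ k)) t) 2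
  induction t with
  | zero =>
    rw [integral_comp_sum_range_one_markovChainLaw hΦ hY]
    simpa using integral_norm_add_sq_le_add_sq hY.aestronglyMeasurable hY_le hμ₀ 0
  | succ t ih =>
    refine (integral_comp_sum_markovChainLaw_succ_le hΦ (fun z => sq_nonneg _) hY hint
      (a := 1) (c := b ^ 2) (fun x z => ?_) t).trans ?_
    · rw [one_mul]
      exact integral_norm_add_sq_le_add_sq hY.aestronglyMeasurable hY_le (hκ x) z
    · push_cast
      linarith

end AdditiveFunctionals

section Scores

variable {S A : Type*} [MeasurableSpace S] [MeasurableSpace A] {m d : ℕ} {ν : Measure A}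

namespace PolicyFamily

variable (π : PolicyFamily S A d ν) {θ θ' : EuclideanSpace ℝ (Fin d)}

/-- The log-density `log π_θ(a | s)` as a function of the pair `(s, a)`. -/
noncomputable def logDens (θ : EuclideanSpace ℝ (Fin d)) (x : S × A) : ℝ :=
  Real.log (π.dens θ x.1 x.2)

/-- The log-likelihood of the actions up to and including time `t`. It omits the transition
probabilities, which do not depend on `θ`. -/
noncomputable def logLik (θ : EuclideanSpace ℝ (Fin d)) (t : ℕ) (τ : ℕ → S × A) : ℝ :=
  ∑ k ∈ Finset.range (t + 1), π.logDens θ (τ k)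

/-- The likelihood ratio `π_θ'(a | s) / π_θ(a | s)` of two policies with positive densities. -/
noncomputable def likelihoodRatio (θ θ' : EuclideanSpace ℝ (Fin d)) (x : S × A) : ℝ≥0∞ :=
  ENNReal.ofReal (Real.exp (π.logDens θ' x - π.logDens θ x))

/-- The accumulated score `∑_{k ≤ t} ∇_θ log π_θ(a_k | s_k)`. -/
noncomputable def scoreSum (θ : EuclideanSpace ℝ (Fin d)) (t : ℕ) (τ : ℕ → S × A) :
    EuclideanSpace ℝ (Fin d) :=
  ∑ k ∈ Finset.range (t + 1), π.score θ (τ k).1 (τ k).2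

lemma measurable_logDens (θ : EuclideanSpace ℝ (Fin d)) : Measurable (π.logDens θ) :=
  (π.measurable_dens θ).log

lemma measurable_logLik (θ : EuclideanSpace ℝ (Fin d)) (t : ℕ) : Measurable (π.logLik θ t) :=
  Finset.measurable_fun_sum _ fun k _ => (π.measurable_logDens θ).comp (measurable_pi_apply k)

lemma measurable_likelihoodRatio (θ θ' : EuclideanSpace ℝ (Fin d)) :
    Measurable (π.likelihoodRatio θ θ') :=
  ((π.measurable_logDens θ').sub (π.measurable_logDens θ)).exp.ennreal_ofReal

lemma prod_toReal_likelihoodRatio (t : ℕ) (τ : ℕ → S × A) :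
    ∏ k ∈ Finset.range (t + 1), (π.likelihoodRatio θ θ' (τ k)).toReal =
      Real.exp (π.logLik θ' t τ - π.logLik θ t τ) := by
  simp_rw [likelihoodRatio, ENNReal.toReal_ofReal (Real.exp_pos _).le]
  rw [← Real.exp_sum, Finset.sum_sub_distrib]
  rfl

lemma ofReal_dens_mul_likelihoodRatio {s : S} {a : A} (hθ : 0 < π.dens θ s a)
    (hθ' : 0 < π.dens θ' s a) :
    ENNReal.ofReal (π.dens θ s a) * π.likelihoodRatio θ θ' (s, a) =
      ENNReal.ofReal (π.dens θ' s a) := by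
  rw [likelihoodRatio, ← ENNReal.ofReal_mul hθ.le, logDens, logDens, Real.exp_sub,
    Real.exp_log hθ', Real.exp_log hθ, mul_div_cancel₀ _ hθ.ne']

variable [SFinite ν]

lemma kernel_apply (θ : EuclideanSpace ℝ (Fin d)) (s : S) :
    π.kernel θ s = ν.withDensity fun a => ENNReal.ofReal (π.dens θ s a) := by
  have hdens : Measurable (Function.uncurry fun s a => ENNReal.ofReal (π.dens θ s a)) :=
    (π.measurable_dens θ).ennreal_ofReal
  rw [kernel, Kernel.withDensity_apply _ hdens, Kernel.const_apply]

lemma kernel_apply_eq_withDensity {s : S} (hθ : ∀ a, 0 < π.dens θ s a)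
    (hθ' : ∀ a, 0 < π.dens θ' s a) :
    π.kernel θ' s = (π.kernel θ s).withDensity fun a => π.likelihoodRatio θ θ' (s, a) := by
  have hdens : Measurable fun a => ENNReal.ofReal (π.dens θ s a) :=
    ((π.measurable_dens θ).comp measurable_prodMk_left).ennreal_ofReal
  have hratio : Measurable fun a => π.likelihoodRatio θ θ' (s, a) :=
    (π.measurable_likelihoodRatio θ θ').comp measurable_prodMk_left
  rw [kernel_apply, kernel_apply, ← withDensity_mul _ hdens hratio]
  congr 1
  ext a
  exact (π.ofReal_dens_mul_likelihoodRatio (hθ a) (hθ' a)).symm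

lemma compProd_kernel_eq_withDensity (hθ : ∀ s a, 0 < π.dens θ s a)
    (hθ' : ∀ s a, 0 < π.dens θ' s a) (μ : Measure S) [SFinite μ] :
    μ ⊗ₘ π.kernel θ' = (μ ⊗ₘ π.kernel θ).withDensity (π.likelihoodRatio θ θ') := by
  ext B hB
  rw [withDensity_apply _ hB, ← lintegral_indicator hB, Measure.lintegral_compProd
    ((π.measurable_likelihoodRatio θ θ').indicator hB), Measure.compProd_apply hB]
  refine lintegral_congr fun s => ?_
  rw [π.kernel_apply_eq_withDensity (hθ s) (hθ' s),
    withDensity_apply _ (measurable_prodMk_left hB),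
    ← lintegral_indicator (measurable_prodMk_left hB)]
  rfl

end PolicyFamily

namespace PolicyFamily.BoundedScore

variable {π : PolicyFamily S A d ν} {U : Set (EuclideanSpace ℝ (Fin d))} {Mg Mh : ℝ}
  {θ : EuclideanSpace ℝ (Fin d)}

lemma hasGradientAt_logDens (hπ : π.BoundedScore U Mg Mh) (hθ : θ ∈ U) (x : S × A) :
    HasGradientAt (fun η => π.logDens η x) (π.score θ x.1 x.2) θ :=
  (hπ.differentiableAt_log θ hθ x.1 x.2).hasGradientAt

lemma measurable_score (hπ : π.BoundedScore U Mg Mh) (hθ : θ ∈ U) :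
    Measurable fun x : S × A => π.score θ x.1 x.2 :=
  measurable_of_hasGradientAt (.of_forall π.measurable_logDens) (hπ.hasGradientAt_logDens hθ)

lemma measurable_scoreSum (hπ : π.BoundedScore U Mg Mh) (hθ : θ ∈ U) (t : ℕ) :
    Measurable (π.scoreSum θ t) :=
  Finset.measurable_fun_sum _ fun k _ => (hπ.measurable_score hθ).comp (measurable_pi_apply k)

lemma hasGradientAt_logLik (hπ : π.BoundedScore U Mg Mh) (hθ : θ ∈ U) (t : ℕ) (τ : ℕ → S × A) :
    HasGradientAt (fun η => π.logLik η t τ) (π.scoreSum θ t τ) θ :=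
  hasGradientAt_finset_sum fun k _ => hπ.hasGradientAt_logDens hθ (τ k)

lemma norm_scoreSum_le (hπ : π.BoundedScore U Mg Mh) (hθ : θ ∈ U) (t : ℕ) (τ : ℕ → S × A) :
    ‖π.scoreSum θ t τ‖ ≤ (t + 1) * Mg :=
  norm_sum_range_le_of_norm_le (fun _ => hπ.norm_score_le θ hθ _ _) t

lemma integrable_score (hπ : π.BoundedScore U Mg Mh) (hθ : θ ∈ U) (μ : Measure (S × A))
    [IsFiniteMeasure μ] : Integrable (fun x : S × A => π.score θ x.1 x.2) μ :=
  .of_bound (hπ.measurable_score hθ).aestronglyMeasurable Mg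
    (.of_forall fun x => hπ.norm_score_le θ hθ x.1 x.2)

variable [SFinite ν]

lemma integral_exp_logDens_sub (hπ : π.BoundedScore U Mg Mh) {θ' : EuclideanSpace ℝ (Fin d)}
    (hθ : θ ∈ U) (hθ' : θ' ∈ U) (s : S) :
    ∫ a, Real.exp (π.logDens θ' (s, a) - π.logDens θ (s, a)) ∂π.kernel θ s = 1 := by
  have hratio : Measurable fun a => π.likelihoodRatio θ θ' (s, a) :=
    (π.measurable_likelihoodRatio θ θ').comp measurable_prodMk_left
  have hone : ∫ _, (1 : ℝ) ∂π.kernel θ' s = 1 := by simp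
  rw [π.kernel_apply_eq_withDensity (hπ.pos θ hθ s) (hπ.pos θ' hθ' s),
    integral_withDensity_eq_integral_toReal_smul hratio
      (.of_forall fun _ => ENNReal.ofReal_lt_top)] at hone
  simpa only [likelihoodRatio, ENNReal.toReal_ofReal (Real.exp_pos _).le, smul_eq_mul, mul_one]
    using hone

lemma integral_score_kernel (hπ : π.BoundedScore U Mg Mh) (hU : IsOpen U) (hθ : θ ∈ U) (s : S) :
    ∫ a, π.score θ s a ∂π.kernel θ s = 0 := by
  have hgrad := hasGradientAt_integral_exp_sub_mul (μ := π.kernel θ s)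
    (l := fun η a => π.logDens η (s, a)) (S := fun η a => π.score η s a)
    (g := fun _ _ => 1) (G := fun _ _ => 0) (B := Mg) (C := 1) (C' := 0) hU hθ
    (fun η _ => (π.measurable_logDens η).comp measurable_prodMk_left)
    (fun _ _ => measurable_const) (fun η hη a => hπ.hasGradientAt_logDens hη (s, a))
    (fun η _ _ => hasGradientAt_const η 1) (fun η hη a => hπ.norm_score_le η hη s a)
    (fun _ _ _ => by simp) (fun _ _ _ => by simp)
  have hconst : HasGradientAt (fun η => ∫ a,
      Real.exp (π.logDens η (s, a) - π.logDens θ (s, a)) * 1 ∂π.kernel θ s) 0 θ := by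
    refine (hasGradientAt_const θ (1 : ℝ)).congr_of_eventuallyEq ?_
    filter_upwards [hU.mem_nhds hθ] with η hη
    simpa only [mul_one] using hπ.integral_exp_logDens_sub hθ hη s
  simpa using hgrad.unique hconst

lemma integral_score_compProd (hπ : π.BoundedScore U Mg Mh) (hU : IsOpen U) (hθ : θ ∈ U)
    (μ : Measure S) [IsFiniteMeasure μ] :
    ∫ x, π.score θ x.1 x.2 ∂(μ ⊗ₘ π.kernel θ) = 0 := by
  rw [Measure.integral_compProd (hπ.integrable_score hθ _)]
  simp [hπ.integral_score_kernel hU hθ]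

end PolicyFamily.BoundedScore

namespace CMDP

variable [SFinite ν] (M : CMDP S A m) (π : PolicyFamily S A d ν)
  {θ θ' : EuclideanSpace ℝ (Fin d)}

lemma trajLaw_eq_markovChainLaw (θ : EuclideanSpace ℝ (Fin d)) :
    M.trajLaw π θ = markovChainLaw (M.ρ ⊗ₘ π.kernel θ) (M.stepKernel π θ) :=
  rfl

instance isProbabilityMeasure_trajLaw (θ : EuclideanSpace ℝ (Fin d)) :
    IsProbabilityMeasure (M.trajLaw π θ) := by
  rw [trajLaw_eq_markovChainLaw]
  infer_instance

lemma stepKernel_apply (θ : EuclideanSpace ℝ (Fin d)) (x : S × A) :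
    M.stepKernel π θ x = M.P x ⊗ₘ π.kernel θ := by
  ext B hB
  rw [stepKernel, Kernel.compProd_apply hB, Measure.compProd_apply hB]
  rfl

lemma integral_trajLaw_eq {E : Type*} [NormedAddCommGroup E] [NormedSpace ℝ E]
    (hθ : ∀ s a, 0 < π.dens θ s a) (hθ' : ∀ s a, 0 < π.dens θ' s a) (t : ℕ)
    {F : (ℕ → S × A) → E} (hF : StronglyMeasurable F) (hFt : DependsOn F (Set.Iic t)) :
    ∫ τ, F τ ∂M.trajLaw π θ' =
      ∫ τ, Real.exp (π.logLik θ' t τ - π.logLik θ t τ) • F τ ∂M.trajLaw π θ := by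
  simp_rw [← π.prod_toReal_likelihoodRatio, trajLaw_eq_markovChainLaw]
  refine integral_markovChainLaw_eq_integral_prod_smul (π.measurable_likelihoodRatio θ θ')
    (fun _ => ENNReal.ofReal_ne_top) (π.compProd_kernel_eq_withDensity hθ hθ' M.ρ)
    (fun x => ?_) t hF hFt
  rw [stepKernel_apply, stepKernel_apply, π.compProd_kernel_eq_withDensity hθ hθ']

variable {π} {U : Set (EuclideanSpace ℝ (Fin d))} {Mg Mh : ℝ}

lemma scoreBound_nonneg (M : CMDP S A m) (hπ : π.BoundedScore U Mg Mh) (hθ : θ ∈ U) :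
    0 ≤ Mg := by
  obtain ⟨τ⟩ : Nonempty (ℕ → S × A) := nonempty_of_isProbabilityMeasure (M.trajLaw π θ)
  exact (norm_nonneg _).trans (hπ.norm_score_le θ hθ (τ 0).1 (τ 0).2)

lemma hasGradientAt_integral_trajLaw (hπ : π.BoundedScore U Mg Mh) (hU : IsOpen U) (hθ : θ ∈ U)
    (t : ℕ) {g : EuclideanSpace ℝ (Fin d) → (ℕ → S × A) → ℝ}
    {G : EuclideanSpace ℝ (Fin d) → (ℕ → S × A) → EuclideanSpace ℝ (Fin d)} {C C' : ℝ}
    (hg_meas : ∀ η ∈ U, Measurable (g η)) (hg_dep : ∀ η ∈ U, DependsOn (g η) (Set.Iic t))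
    (hg : ∀ η ∈ U, ∀ τ, HasGradientAt (fun η => g η τ) (G η τ) η)
    (hg_le : ∀ η ∈ U, ∀ τ, |g η τ| ≤ C) (hG_le : ∀ η ∈ U, ∀ τ, ‖G η τ‖ ≤ C') :
    HasGradientAt (fun η => ∫ τ, g η τ ∂M.trajLaw π η)
      (∫ τ, (g θ τ • π.scoreSum θ t τ + G θ τ) ∂M.trajLaw π θ) θ := by
  refine (hasGradientAt_integral_exp_sub_mul (μ := M.trajLaw π θ) hU hθ
    (fun η _ => π.measurable_logLik η t) hg_meas (fun η hη τ => hπ.hasGradientAt_logLik hη t τ) hg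
    (fun η hη τ => hπ.norm_scoreSum_le hη t τ) hg_le hG_le).congr_of_eventuallyEq ?_
  filter_upwards [hU.mem_nhds hθ] with η hη
  exact M.integral_trajLaw_eq π (hπ.pos θ hθ) (hπ.pos η hη) t (hg_meas η hη).stronglyMeasurable
    (hg_dep η hη)

section ScoreMoments

variable (hπ : π.BoundedScore U Mg Mh) (hU : IsOpen U) (hθ : θ ∈ U)
include hπ hU hθ

lemma integral_score_stepKernel (x : S × A) :
    ∫ y, π.score θ y.1 y.2 ∂M.stepKernel π θ x = 0 := by
  rw [stepKernel_apply]
  exact hπ.integral_score_compProd hU hθ _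

lemma integral_cosh_mul_norm_scoreSum_le (c : ℝ) (t : ℕ) :
    ∫ τ, Real.cosh (c * ‖π.scoreSum θ t τ‖) ∂M.trajLaw π θ ≤ Real.cosh (c * Mg) ^ (t + 1) := by
  have hbound : ∀ x : S × A, ‖c • π.score θ x.1 x.2‖ ≤ |c| * Mg := fun x => by
    rw [norm_smul, Real.norm_eq_abs]
    exact mul_le_mul_of_nonneg_left (hπ.norm_score_le θ hθ _ _) (abs_nonneg c)
  have hle := integral_cosh_norm_sum_markovChainLaw_le (μ₀ := M.ρ ⊗ₘ π.kernel θ)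
    (κ := M.stepKernel π θ) ((hπ.measurable_score hθ).stronglyMeasurable.const_smul c) hbound
    (by simp [integral_smul, hπ.integral_score_compProd hU hθ])
    (fun x => by simp [integral_smul, M.integral_score_stepKernel hπ hU hθ]) t
  have hcosh (x : ℝ) (hx : 0 ≤ x) : Real.cosh (|c| * x) = Real.cosh (c * x) := by
    rw [← Real.cosh_abs (c * x), abs_mul, abs_of_nonneg hx]
  simp only [Pi.smul_apply, ← Finset.smul_sum, norm_smul, Real.norm_eq_abs,
    hcosh _ (norm_nonneg _), hcosh _ (M.scoreBound_nonneg hπ hθ)] at hle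
  exact hle

lemma integral_inner_scoreSum_sq_le (u : EuclideanSpace ℝ (Fin d)) (t : ℕ) :
    ∫ τ, ⟪u, π.scoreSum θ t τ⟫ ^ 2 ∂M.trajLaw π θ ≤ (t + 1) * (‖u‖ * Mg) ^ 2 := by
  have hbound : ∀ x : S × A, ‖⟪u, π.score θ x.1 x.2⟫‖ ≤ ‖u‖ * Mg := fun x =>
    (norm_inner_le_norm _ _).trans
      (mul_le_mul_of_nonneg_left (hπ.norm_score_le θ hθ _ _) (norm_nonneg u))
  have hle := integral_norm_sum_sq_markovChainLaw_le (μ₀ := M.ρ ⊗ₘ π.kernel θ)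
    (κ := M.stepKernel π θ) ((hπ.measurable_score hθ).const_inner (c := u)).stronglyMeasurable
    hbound
    (by rw [integral_inner (hπ.integrable_score hθ _), hπ.integral_score_compProd hU hθ,
      inner_zero_right])
    (fun x => by rw [integral_inner (hπ.integrable_score hθ _),
      M.integral_score_stepKernel hπ hU hθ, inner_zero_right]) t
  simp only [← inner_sum, Real.norm_eq_abs, sq_abs] at hle
  exact hle

end ScoreMoments

end CMDP

end Scores

section PolicyGradient

variable {S A : Type*} [MeasurableSpace S] [MeasurableSpace A] {m d : ℕ} {ν : Measure A}

namespace CMDP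

variable (M : CMDP S A m) (π : PolicyFamily S A d ν)

/-- The likelihood-ratio gradient `r_i(s_t, a_t) ∑_{k ≤ t} ∇_θ log π_θ(a_k | s_k)`, the integrand
of the policy gradient of the reward at time `t`. -/
noncomputable def rewardScore (i : Fin (m + 1)) (t : ℕ) (θ : EuclideanSpace ℝ (Fin d))
    (τ : ℕ → S × A) : EuclideanSpace ℝ (Fin d) :=
  M.r i (τ t) • π.scoreSum θ t τ

lemma abs_r_le_one (i : Fin (m + 1)) (x : S × A) : |M.r i x| ≤ 1 :=
  abs_le.2 (M.utility_mem i x)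

lemma measurable_r_apply (i : Fin (m + 1)) (t : ℕ) :
    Measurable fun τ : ℕ → S × A => M.r i (τ t) :=
  (M.measurable_r i).comp (measurable_pi_apply t)

lemma dependsOn_r_apply (i : Fin (m + 1)) (t : ℕ) :
    DependsOn (fun τ : ℕ → S × A => M.r i (τ t)) (Set.Iic t) := fun τ τ' h => by
  simp only [h t (Set.mem_Iic.2 le_rfl)]

section RewardScore

variable {π} {U : Set (EuclideanSpace ℝ (Fin d))} {Mg Mh : ℝ} {θ : EuclideanSpace ℝ (Fin d)}
  (hπ : π.BoundedScore U Mg Mh) (hθ : θ ∈ U)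
include hπ hθ

lemma measurable_rewardScore (i : Fin (m + 1)) (t : ℕ) : Measurable (M.rewardScore π i t θ) :=
  (M.measurable_r_apply i t).smul (hπ.measurable_scoreSum hθ t)

lemma norm_rewardScore_le (i : Fin (m + 1)) (t : ℕ) (τ : ℕ → S × A) :
    ‖M.rewardScore π i t θ τ‖ ≤ (t + 1) * Mg := by
  rw [rewardScore, norm_smul]
  exact (mul_le_of_le_one_left (norm_nonneg _) (M.abs_r_le_one i _)).trans
    (hπ.norm_scoreSum_le hθ t τ)

end RewardScore

variable [SFinite ν]

/-- The expected reward `𝔼[r_i(s_t, a_t)]` at time `t`. -/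
noncomputable def expReward (i : Fin (m + 1)) (t : ℕ) (θ : EuclideanSpace ℝ (Fin d)) : ℝ :=
  ∫ τ, M.r i (τ t) ∂M.trajLaw π θ

/-- The policy gradient `∇_θ 𝔼[r_i(s_t, a_t)]` of the expected reward at time `t`, in its
likelihood-ratio form. -/
noncomputable def expRewardGrad (i : Fin (m + 1)) (t : ℕ) (θ : EuclideanSpace ℝ (Fin d)) :
    EuclideanSpace ℝ (Fin d) :=
  ∫ τ, M.rewardScore π i t θ τ ∂M.trajLaw π θ

lemma hasSum_expReward (i : Fin (m + 1)) (θ : EuclideanSpace ℝ (Fin d)) :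
    HasSum (fun t => M.γ ^ t * M.expReward π i t θ) (M.value π i θ) := by
  have hle (t : ℕ) (τ : ℕ → S × A) : ‖M.γ ^ t * M.r i (τ t)‖ ≤ M.γ ^ t := by
    rw [norm_mul, Real.norm_of_nonneg (pow_nonneg M.γ_pos.le t)]
    exact mul_le_of_le_one_right (pow_nonneg M.γ_pos.le t) (M.abs_r_le_one i _)
  have hint (t : ℕ) : Integrable (fun τ : ℕ → S × A => M.γ ^ t * M.r i (τ t)) (M.trajLaw π θ) :=
    .of_bound ((M.measurable_r_apply i t).const_mul _).aestronglyMeasurable _ (.of_forall (hle t))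
  have hnorm (t : ℕ) : ∫ τ, ‖M.γ ^ t * M.r i (τ t)‖ ∂M.trajLaw π θ ≤ M.γ ^ t := by
    simpa using integral_mono (hint t).norm (integrable_const (M.γ ^ t)) (hle t)
  have hsum := hasSum_integral_of_summable_integral_norm hint
    ((summable_geometric_of_lt_one M.γ_pos.le M.γ_lt_one).of_nonneg_of_le
      (fun t => integral_nonneg fun τ => norm_nonneg _) hnorm)
  simp only [integral_const_mul] at hsum
  exact hsum

section Gradient

variable {π} {U : Set (EuclideanSpace ℝ (Fin d))} {Mg Mh : ℝ} {θ : EuclideanSpace ℝ (Fin d)}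
  (hπ : π.BoundedScore U Mg Mh)
include hπ

lemma memLp_scoreSum (hθ : θ ∈ U) (t : ℕ) (p : ℝ≥0∞) :
    MemLp (π.scoreSum θ t) p (M.trajLaw π θ) :=
  .of_bound (hπ.measurable_scoreSum hθ t).aestronglyMeasurable ((t + 1) * Mg)
    (.of_forall (hπ.norm_scoreSum_le hθ t))

lemma memLp_rewardScore (hθ : θ ∈ U) (i : Fin (m + 1)) (t : ℕ) (p : ℝ≥0∞) :
    MemLp (M.rewardScore π i t θ) p (M.trajLaw π θ) :=
  .of_bound (M.measurable_rewardScore hπ hθ i t).aestronglyMeasurable ((t + 1) * Mg)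
    (.of_forall (M.norm_rewardScore_le hπ hθ i t))

lemma integrable_rewardScore (hθ : θ ∈ U) (i : Fin (m + 1)) (t : ℕ) :
    Integrable (M.rewardScore π i t θ) (M.trajLaw π θ) :=
  (M.memLp_rewardScore hπ hθ i t 1).integrable le_rfl

variable (hU : IsOpen U)
include hU

lemma hasGradientAt_expReward (hθ : θ ∈ U) (i : Fin (m + 1)) (t : ℕ) :
    HasGradientAt (M.expReward π i t) (M.expRewardGrad π i t θ) θ := by
  have hgrad := M.hasGradientAt_integral_trajLaw hπ hU hθ t (g := fun _ τ => M.r i (τ t))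
    (G := fun _ _ => 0) (C := 1) (C' := 0) (fun _ _ => M.measurable_r_apply i t)
    (fun _ _ => M.dependsOn_r_apply i t) (fun η _ _ => hasGradientAt_const η _)
    (fun _ _ _ => M.abs_r_le_one i _) (fun _ _ _ => norm_zero.le)
  simp only [add_zero] at hgrad
  exact hgrad

lemma integral_inner_rewardScore_sq_le (hθ : θ ∈ U) (i : Fin (m + 1)) (t : ℕ)
    (u : EuclideanSpace ℝ (Fin d)) :
    ∫ τ, ⟪u, M.rewardScore π i t θ τ⟫ ^ 2 ∂M.trajLaw π θ ≤ (‖u‖ * (Mg * √(t + 1))) ^ 2 := by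
  have hint := ((M.memLp_scoreSum hπ hθ t 2).const_inner u).integrable_sq
  calc ∫ τ, ⟪u, M.rewardScore π i t θ τ⟫ ^ 2 ∂M.trajLaw π θ
      ≤ ∫ τ, ⟪u, π.scoreSum θ t τ⟫ ^ 2 ∂M.trajLaw π θ := by
        refine integral_mono_of_nonneg (.of_forall fun τ => sq_nonneg _) hint
          (.of_forall fun τ => ?_)
        simp only [rewardScore, real_inner_smul_right, mul_pow]
        exact mul_le_of_le_one_left (sq_nonneg _) ((sq_le_one_iff_abs_le_one _).2
          (M.abs_r_le_one i _))
    _ ≤ (t + 1) * (‖u‖ * Mg) ^ 2 := M.integral_inner_scoreSum_sq_le hπ hU hθ u t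
    _ = (‖u‖ * (Mg * √(t + 1))) ^ 2 := by
        rw [← mul_assoc, mul_pow _ √_, Real.sq_sqrt (by positivity), mul_comm]

lemma norm_expRewardGrad_le (hθ : θ ∈ U) (i : Fin (m + 1)) (t : ℕ) :
    ‖M.expRewardGrad π i t θ‖ ≤ Mg * √(t + 1) :=
  norm_integral_le_of_integral_inner_sq_le (M.memLp_rewardScore hπ hθ i t 2)
    (mul_nonneg (M.scoreBound_nonneg hπ hθ) (Real.sqrt_nonneg _))
    (M.integral_inner_rewardScore_sq_le hπ hU hθ i t)

lemma norm_pow_smul_expRewardGrad_le (hθ : θ ∈ U) (i : Fin (m + 1)) (t : ℕ) :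
    ‖M.γ ^ t • M.expRewardGrad π i t θ‖ ≤ Mg * (M.γ ^ t * √(t + 1)) := by
  rw [norm_smul, Real.norm_of_nonneg (pow_nonneg M.γ_pos.le t), mul_left_comm]
  exact mul_le_mul_of_nonneg_left (M.norm_expRewardGrad_le hπ hU hθ i t)
    (pow_nonneg M.γ_pos.le t)

end Gradient

end CMDP

end PolicyGradient

section PolicyHessian

variable {S A : Type*} [MeasurableSpace S] [MeasurableSpace A] {m d : ℕ} {ν : Measure A}

namespace PolicyFamily

/-- The accumulated Hessian `∑_{k ≤ t} ∇²_θ log π_θ(a_k | s_k)`. -/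
noncomputable def hessianSum (π : PolicyFamily S A d ν) (θ : EuclideanSpace ℝ (Fin d)) (t : ℕ)
    (τ : ℕ → S × A) : EuclideanSpace ℝ (Fin d) →L[ℝ] EuclideanSpace ℝ (Fin d) :=
  ∑ k ∈ Finset.range (t + 1), π.hessian θ (τ k).1 (τ k).2

lemma dependsOn_scoreSum (π : PolicyFamily S A d ν) (θ : EuclideanSpace ℝ (Fin d)) (t : ℕ) :
    DependsOn (π.scoreSum θ t) (Set.Iic t) := by
  intro τ τ' h
  exact Finset.sum_congr rfl fun k hk => by
    rw [h k (Set.mem_Iic.2 (Nat.lt_succ_iff.1 (Finset.mem_range.1 hk)))]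

end PolicyFamily

namespace PolicyFamily.BoundedScore

variable {π : PolicyFamily S A d ν} {U : Set (EuclideanSpace ℝ (Fin d))} {Mg Mh : ℝ}
  {θ : EuclideanSpace ℝ (Fin d)} (hπ : π.BoundedScore U Mg Mh)
include hπ

lemma hasFDerivAt_scoreSum (hθ : θ ∈ U) (t : ℕ) (τ : ℕ → S × A) :
    HasFDerivAt (fun η => π.scoreSum η t τ) (π.hessianSum θ t τ) θ :=
  HasFDerivAt.fun_sum fun k _ => (hπ.differentiableAt_score θ hθ (τ k).1 (τ k).2).hasFDerivAt

lemma norm_hessianSum_le (hθ : θ ∈ U) (t : ℕ) (τ : ℕ → S × A) :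
    ‖π.hessianSum θ t τ‖ ≤ (t + 1) * Mh :=
  norm_sum_range_le_of_norm_le (fun _ => hπ.norm_hessian_le θ hθ _ _) t

lemma measurable_adjoint_hessianSum (hU : IsOpen U) (hθ : θ ∈ U) (t : ℕ)
    (u : EuclideanSpace ℝ (Fin d)) :
    Measurable fun τ => ContinuousLinearMap.adjoint (π.hessianSum θ t τ) u :=
  measurable_of_hasGradientAt
    (Filter.eventually_of_mem (hU.mem_nhds hθ) fun _ hη =>
      (hπ.measurable_scoreSum hη t).const_inner)
    fun τ => hasGradientAt_const_inner (hπ.hasFDerivAt_scoreSum hθ t τ) u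

lemma norm_adjoint_hessianSum_le (hθ : θ ∈ U) (t : ℕ) (u : EuclideanSpace ℝ (Fin d))
    (τ : ℕ → S × A) :
    ‖ContinuousLinearMap.adjoint (π.hessianSum θ t τ) u‖ ≤ (t + 1) * Mh * ‖u‖ := by
  refine (ContinuousLinearMap.le_opNorm _ _).trans ?_
  rw [LinearIsometryEquiv.norm_map]
  exact mul_le_mul_of_nonneg_right (hπ.norm_hessianSum_le hθ t τ) (norm_nonneg u)

end PolicyFamily.BoundedScore

namespace CMDP

variable (M : CMDP S A m) (π : PolicyFamily S A d ν)

/-- The likelihood-ratio Hessian–vector product of the reward at time `t` in the direction `u`: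
its expectation is the gradient of `θ ↦ ⟪u, ∇_θ 𝔼[r_i(s_t, a_t)]⟫`. -/
noncomputable def rewardHessian (i : Fin (m + 1)) (t : ℕ) (θ u : EuclideanSpace ℝ (Fin d))
    (τ : ℕ → S × A) : EuclideanSpace ℝ (Fin d) :=
  ⟪u, M.rewardScore π i t θ τ⟫ • π.scoreSum θ t τ +
    M.r i (τ t) • ContinuousLinearMap.adjoint (π.hessianSum θ t τ) u

lemma dependsOn_rewardScore (i : Fin (m + 1)) (t : ℕ) (θ : EuclideanSpace ℝ (Fin d)) :
    DependsOn (M.rewardScore π i t θ) (Set.Iic t) := fun τ τ' h => by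
  simp only [rewardScore, M.dependsOn_r_apply i t h, π.dependsOn_scoreSum θ t h]

variable {π} {U : Set (EuclideanSpace ℝ (Fin d))} {Mg Mh : ℝ} {θ : EuclideanSpace ℝ (Fin d)}
  (hπ : π.BoundedScore U Mg Mh)
include hπ

lemma hasGradientAt_inner_rewardScore (hθ : θ ∈ U) (i : Fin (m + 1)) (t : ℕ)
    (u : EuclideanSpace ℝ (Fin d)) (τ : ℕ → S × A) :
    HasGradientAt (fun η => ⟪u, M.rewardScore π i t η τ⟫)
      (M.r i (τ t) • ContinuousLinearMap.adjoint (π.hessianSum θ t τ) u) θ := by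
  simp only [rewardScore, real_inner_smul_right]
  exact hasGradientAt_const_mul
    (hasGradientAt_const_inner (hπ.hasFDerivAt_scoreSum hθ t τ) u) _

lemma abs_inner_rewardScore_le (hθ : θ ∈ U) (i : Fin (m + 1)) (t : ℕ)
    (u : EuclideanSpace ℝ (Fin d)) (τ : ℕ → S × A) :
    |⟪u, M.rewardScore π i t θ τ⟫| ≤ ‖u‖ * ((t + 1) * Mg) :=
  (abs_real_inner_le_norm _ _).trans
    (mul_le_mul_of_nonneg_left (M.norm_rewardScore_le hπ hθ i t τ) (norm_nonneg u))

lemma norm_r_smul_adjoint_hessianSum_le (hθ : θ ∈ U) (i : Fin (m + 1)) (t : ℕ)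
    (u : EuclideanSpace ℝ (Fin d)) (τ : ℕ → S × A) :
    ‖M.r i (τ t) • ContinuousLinearMap.adjoint (π.hessianSum θ t τ) u‖ ≤ (t + 1) * Mh * ‖u‖ := by
  rw [norm_smul]
  exact (mul_le_of_le_one_left (norm_nonneg _) (M.abs_r_le_one i _)).trans
    (hπ.norm_adjoint_hessianSum_le hθ t u τ)

lemma inner_rewardHessian_le (hθ : θ ∈ U) (i : Fin (m + 1)) (t : ℕ)
    (u : EuclideanSpace ℝ (Fin d)) (τ : ℕ → S × A) :
    ⟪u, M.rewardHessian π i t θ u τ⟫ ≤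
      ⟪u, π.scoreSum θ t τ⟫ ^ 2 + (t + 1) * (Mh * ‖u‖ ^ 2) := by
  have hscore : ⟪u, M.rewardScore π i t θ τ⟫ * ⟪u, π.scoreSum θ t τ⟫ ≤
      ⟪u, π.scoreSum θ t τ⟫ ^ 2 := by
    rw [rewardScore, real_inner_smul_right, mul_assoc, ← sq]
    exact mul_le_of_le_one_left (sq_nonneg _) (abs_le.1 (M.abs_r_le_one i _)).2
  have hhess : ⟪u, M.r i (τ t) • ContinuousLinearMap.adjoint (π.hessianSum θ t τ) u⟫ ≤
      ‖u‖ * ((t + 1) * Mh * ‖u‖) :=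
    (real_inner_le_norm _ _).trans (mul_le_mul_of_nonneg_left
      (M.norm_r_smul_adjoint_hessianSum_le hπ hθ i t u τ) (norm_nonneg u))
  rw [rewardHessian, inner_add_right, real_inner_smul_right]
  linarith

variable [SFinite ν] (hU : IsOpen U)
include hU

lemma integrable_rewardHessian (hθ : θ ∈ U) (i : Fin (m + 1)) (t : ℕ)
    (u : EuclideanSpace ℝ (Fin d)) :
    Integrable (M.rewardHessian π i t θ u) (M.trajLaw π θ) := by
  have hinner : Integrable (fun τ => ⟪u, M.rewardScore π i t θ τ⟫) (M.trajLaw π θ) :=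
    (M.integrable_rewardScore hπ hθ i t).const_inner u
  have hscore : Integrable ((fun τ => ⟪u, M.rewardScore π i t θ τ⟫) • π.scoreSum θ t)
      (M.trajLaw π θ) := hinner.smul_of_top_left (M.memLp_scoreSum hπ hθ t ∞)
  have hhess : Integrable
      (fun τ => M.r i (τ t) • ContinuousLinearMap.adjoint (π.hessianSum θ t τ) u)
      (M.trajLaw π θ) :=
    .of_bound ((M.measurable_r_apply i t).smul
      (hπ.measurable_adjoint_hessianSum hU hθ t u)).aestronglyMeasurable ((t + 1) * Mh * ‖u‖)
      (.of_forall (M.norm_r_smul_adjoint_hessianSum_le hπ hθ i t u))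
  exact hscore.add hhess

lemma hasGradientAt_inner_expRewardGrad (hθ : θ ∈ U) (i : Fin (m + 1)) (t : ℕ)
    (u : EuclideanSpace ℝ (Fin d)) :
    HasGradientAt (fun η => ⟪u, M.expRewardGrad π i t η⟫)
      (∫ τ, M.rewardHessian π i t θ u τ ∂M.trajLaw π θ) θ := by
  refine (M.hasGradientAt_integral_trajLaw hπ hU hθ t
    (g := fun η τ => ⟪u, M.rewardScore π i t η τ⟫)
    (fun η hη => (M.measurable_rewardScore hπ hη i t).const_inner)
    (fun η _ τ τ' h => by simp only [M.dependsOn_rewardScore π i t η h])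
    (fun η hη => M.hasGradientAt_inner_rewardScore hπ hη i t u)
    (fun η hη => M.abs_inner_rewardScore_le hπ hη i t u)
    (fun η hη => M.norm_r_smul_adjoint_hessianSum_le hπ hη i t u)).congr_of_eventuallyEq ?_
  filter_upwards [hU.mem_nhds hθ] with η hη
  exact (integral_inner (M.integrable_rewardScore hπ hη i t) u).symm

lemma inner_integral_rewardHessian_le (hθ : θ ∈ U) (i : Fin (m + 1)) (t : ℕ)
    (u : EuclideanSpace ℝ (Fin d)) :
    ⟪u, ∫ τ, M.rewardHessian π i t θ u τ ∂M.trajLaw π θ⟫ ≤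
      (t + 1) * ((Mg ^ 2 + Mh) * ‖u‖ ^ 2) := by
  have hint := M.integrable_rewardHessian hπ hU hθ i t u
  have hinner : Integrable (fun τ => ⟪u, M.rewardHessian π i t θ u τ⟫) (M.trajLaw π θ) :=
    hint.const_inner u
  have hsq : Integrable (fun τ => ⟪u, π.scoreSum θ t τ⟫ ^ 2) (M.trajLaw π θ) :=
    ((M.memLp_scoreSum hπ hθ t 2).const_inner u).integrable_sq
  have hle := integral_mono hinner (hsq.add (integrable_const ((t + 1) * (Mh * ‖u‖ ^ 2))))
    (M.inner_rewardHessian_le hπ hθ i t u)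
  simp only [Pi.add_apply] at hle
  rw [integral_inner hint u, integral_add hsq (integrable_const _), integral_const,
    probReal_univ, one_smul] at hle
  linarith [M.integral_inner_scoreSum_sq_le hπ hU hθ u t]

lemma expReward_le_add_inner_add {V : Set (EuclideanSpace ℝ (Fin d))} (hV : Convex ℝ V)
    (hVU : V ⊆ U) (i : Fin (m + 1)) (t : ℕ) {x y : EuclideanSpace ℝ (Fin d)} (hx : x ∈ V)
    (hy : y ∈ V) :
    M.expReward π i t x ≤ M.expReward π i t y + ⟪M.expRewardGrad π i t y, x - y⟫ +
      (t + 1) * ((Mg ^ 2 + Mh) * ‖x - y‖ ^ 2) / 2 :=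
  le_add_inner_add_half_of_hasGradientAt hV hx hy
    (fun _ hz => M.hasGradientAt_expReward hπ hU (hVU hz) i t)
    (fun _ hz => M.hasGradientAt_inner_expRewardGrad hπ hU (hVU hz) i t (x - y))
    (fun _ hz => M.inner_integral_rewardHessian_le hπ hU (hVU hz) i t (x - y))

end CMDP

end PolicyHessian

section Value

variable {S A : Type*} [MeasurableSpace S] [MeasurableSpace A] {m d : ℕ} {ν : Measure A}
  [SFinite ν]

namespace CMDP

variable (M : CMDP S A m) (π : PolicyFamily S A d ν)

/-- The policy gradient `∇_θ V_i^θ(ρ)`, as the discounted series of the gradients of the expected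
rewards. -/
noncomputable def valueGrad (i : Fin (m + 1)) (θ : EuclideanSpace ℝ (Fin d)) :
    EuclideanSpace ℝ (Fin d) :=
  ∑' t : ℕ, M.γ ^ t • M.expRewardGrad π i t θ

variable {π} {U : Set (EuclideanSpace ℝ (Fin d))} {Mg Mh : ℝ} {θ : EuclideanSpace ℝ (Fin d)}
  (hπ : π.BoundedScore U Mg Mh) (hU : IsOpen U)

include hπ hU

lemma norm_pow_smul_expRewardGrad_le_mul_add_one (hθ : θ ∈ U) (i : Fin (m + 1)) (t : ℕ) :
    ‖M.γ ^ t • M.expRewardGrad π i t θ‖ ≤ Mg * (M.γ ^ t * (t + 1)) := by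
  have hγ := M.γ_pos
  have hMg := M.scoreBound_nonneg hπ hθ
  refine (M.norm_pow_smul_expRewardGrad_le hπ hU hθ i t).trans ?_
  gcongr
  exact Real.sqrt_le_self_iff.2 (.inr (by simp))

lemma hasSum_valueGrad (hθ : θ ∈ U) (i : Fin (m + 1)) :
    HasSum (fun t => M.γ ^ t • M.expRewardGrad π i t θ) (M.valueGrad π i θ) :=
  (Summable.of_norm_bounded
    ((hasSum_geometric_mul_add_one M.γ_pos.le M.γ_lt_one).summable.mul_left Mg)
    (M.norm_pow_smul_expRewardGrad_le_mul_add_one hπ hU hθ i)).hasSum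

lemma norm_valueGrad_le (hθ : θ ∈ U) (i : Fin (m + 1)) :
    ‖M.valueGrad π i θ‖ ≤ Mg / (1 - M.γ) ^ 2 := by
  rw [← mul_one_div]
  exact tsum_of_norm_bounded
    ((hasSum_geometric_mul_add_one M.γ_pos.le M.γ_lt_one).mul_left Mg)
    (M.norm_pow_smul_expRewardGrad_le_mul_add_one hπ hU hθ i)

lemma hasGradientAt_value (hθ : θ ∈ U) (i : Fin (m + 1)) :
    HasGradientAt (M.value π i) (M.valueGrad π i θ) θ := by
  have hvalue : M.value π i = fun η => ∑' t, M.γ ^ t * M.expReward π i t η :=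
    funext fun η => (M.hasSum_expReward π i η).tsum_eq.symm
  rw [hvalue]
  exact hasGradientAt_tsum hU hθ
    ((hasSum_geometric_mul_add_one M.γ_pos.le M.γ_lt_one).summable.mul_left Mg)
    (fun t η hη => hasGradientAt_const_mul (M.hasGradientAt_expReward hπ hU hη i t) _)
    (fun t η hη => M.norm_pow_smul_expRewardGrad_le_mul_add_one hπ hU hη i t)
    (M.hasSum_expReward π i θ).summable

lemma lipschitzContOn_value (i : Fin (m + 1)) {X : Set (EuclideanSpace ℝ (Fin d))}
    (hX : convexHull ℝ X ⊆ U) :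
    LipschitzContOn (M.value π i) (Mg / (1 - M.γ) ^ 2) X := fun _ hx _ hy =>
  abs_sub_le_of_hasGradientAt (convex_convexHull ℝ X)
    (fun _ hz => M.hasGradientAt_value hπ hU (hX hz) i)
    (fun _ hz => M.norm_valueGrad_le hπ hU (hX hz) i)
    (subset_convexHull ℝ X hx) (subset_convexHull ℝ X hy)

lemma mSmoothOn_value (i : Fin (m + 1)) {X : Set (EuclideanSpace ℝ (Fin d))}
    (hX : convexHull ℝ X ⊆ U) :
    MSmoothOn (M.value π i) ((Mg ^ 2 + Mh) / (1 - M.γ) ^ 2) X := by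
  intro x hx y hy
  have hx' := subset_convexHull ℝ X hx
  have hy' := subset_convexHull ℝ X hy
  have hgrad : HasSum (fun t => M.γ ^ t * ⟪M.expRewardGrad π i t y, x - y⟫)
      ⟪M.valueGrad π i y, x - y⟫ := by
    have hsum := (M.hasSum_valueGrad hπ hU (hX hy') i).mapL (innerSL ℝ (x - y))
    simpa only [innerSL_apply_apply, real_inner_comm, real_inner_smul_left] using hsum
  have hquad := (hasSum_geometric_mul_add_one M.γ_pos.le M.γ_lt_one).mul_right
    ((Mg ^ 2 + Mh) * ‖x - y‖ ^ 2 / 2)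
  rw [(M.hasGradientAt_value hπ hU (hX hy') i).gradient]
  refine (hasSum_le (fun t => ?_) (M.hasSum_expReward π i x)
    (((M.hasSum_expReward π i y).add hgrad).add hquad)).trans_eq (by ring)
  have htaylor := M.expReward_le_add_inner_add hπ hU (convex_convexHull ℝ X) hX i t hx' hy'
  calc M.γ ^ t * M.expReward π i t x
      ≤ M.γ ^ t * (M.expReward π i t y + ⟪M.expRewardGrad π i t y, x - y⟫ +
          (t + 1) * ((Mg ^ 2 + Mh) * ‖x - y‖ ^ 2) / 2) :=
        mul_le_mul_of_nonneg_left htaylor (pow_nonneg M.γ_pos.le t)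
    _ = _ := by ring

end CMDP

end Value

section Estimators

variable {S A : Type*} [MeasurableSpace S] [MeasurableSpace A] {m d : ℕ} {ν : Measure A}

namespace CMDP

variable (M : CMDP S A m) (π : PolicyFamily S A d ν) {n H : ℕ}

/-- The discounted reward of a single truncated trajectory. -/
noncomputable def trajValue (i : Fin (m + 1)) (x : Fin H → S × A) : ℝ :=
  ∑ t : Fin H, M.γ ^ (t : ℕ) * M.r i (x t)

/-- The GPOMDP gradient estimate from a single truncated trajectory. -/
noncomputable def trajGrad (i : Fin (m + 1)) (θ : EuclideanSpace ℝ (Fin d)) (x : Fin H → S × A) :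
    EuclideanSpace ℝ (Fin d) :=
  ∑ t : Fin H, ∑ t' ∈ Finset.Iic t, (M.γ ^ (t : ℕ) * M.r i (x t)) • π.score θ (x t').1 (x t').2

lemma valueEst_eq_sampleMean (i : Fin (m + 1)) (τ : Fin n → Fin H → S × A) :
    M.valueEst i τ = sampleMean (M.trajValue i) τ := by
  rw [sampleMean, Fintype.card_fin]
  rfl

lemma gradEst_eq_sampleMean (i : Fin (m + 1)) (θ : EuclideanSpace ℝ (Fin d))
    (τ : Fin n → Fin H → S × A) :
    M.gradEst π i θ τ = sampleMean (M.trajGrad π i θ) τ := by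
  rw [sampleMean, Fintype.card_fin]
  rfl

lemma trajValue_restrict (i : Fin (m + 1)) (τ : ℕ → S × A) :
    M.trajValue i (fun t : Fin H => τ t) = ∑ t ∈ Finset.range H, M.γ ^ t * M.r i (τ t) :=
  Fin.sum_univ_eq_sum_range (fun t => M.γ ^ t * M.r i (τ t)) H

lemma trajGrad_restrict (i : Fin (m + 1)) (θ : EuclideanSpace ℝ (Fin d)) (τ : ℕ → S × A) :
    M.trajGrad π i θ (fun t : Fin H => τ t) =
      ∑ t ∈ Finset.range H, M.γ ^ t • M.rewardScore π i t θ τ := by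
  rw [← Fin.sum_univ_eq_sum_range (fun t => M.γ ^ t • M.rewardScore π i t θ τ) H]
  refine Finset.sum_congr rfl fun t _ => ?_
  rw [rewardScore, smul_smul, PolicyFamily.scoreSum, Finset.smul_sum, Nat.range_succ_eq_Iic,
    ← Fin.map_valEmbedding_Iic, Finset.sum_map]
  rfl

lemma measurable_trajValue (i : Fin (m + 1)) : Measurable (M.trajValue i (H := H)) :=
  Finset.measurable_fun_sum _ fun t _ =>
    ((M.measurable_r i).comp (measurable_pi_apply t)).const_mul _

lemma abs_trajValue_le (i : Fin (m + 1)) (x : Fin H → S × A) :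
    |M.trajValue i x| ≤ 1 / (1 - M.γ) := by
  have hγ := M.γ_pos.le
  calc |M.trajValue i x| ≤ ∑ t : Fin H, |M.γ ^ (t : ℕ) * M.r i (x t)| :=
        Finset.abs_sum_le_sum_abs _ _
    _ ≤ ∑ t : Fin H, M.γ ^ (t : ℕ) := Finset.sum_le_sum fun t _ => by
        rw [abs_mul, abs_of_nonneg (by positivity)]
        exact mul_le_of_le_one_right (by positivity) (M.abs_r_le_one i _)
    _ = ∑ t ∈ Finset.range H, M.γ ^ t := Fin.sum_univ_eq_sum_range (fun t => M.γ ^ t) H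
    _ ≤ (1 - M.γ)⁻¹ := sum_le_hasSum _ (fun t _ => by positivity)
        (hasSum_geometric_of_lt_one hγ M.γ_lt_one)
    _ = 1 / (1 - M.γ) := (one_div _).symm

section Law

variable [SFinite ν] (θ : EuclideanSpace ℝ (Fin d))

lemma hasLaw_truncLaw (H : ℕ) :
    HasLaw (fun (τ : ℕ → S × A) (t : Fin H) => τ t) (M.truncLaw π θ H) (M.trajLaw π θ) :=
  ⟨(measurable_pi_iff.2 fun t : Fin H => measurable_pi_apply (t : ℕ)).aemeasurable, rfl⟩

instance isProbabilityMeasure_truncLaw (H : ℕ) : IsProbabilityMeasure (M.truncLaw π θ H) :=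
  Measure.isProbabilityMeasure_map (M.hasLaw_truncLaw π θ H).aemeasurable

lemma integrable_trajValue (i : Fin (m + 1)) : Integrable (M.trajValue i) (M.truncLaw π θ H) :=
  .of_bound (M.measurable_trajValue i).aestronglyMeasurable _
    (.of_forall (M.abs_trajValue_le i))

lemma integral_trajValue (i : Fin (m + 1)) :
    ∫ x, M.trajValue i x ∂M.truncLaw π θ H =
      ∑ t ∈ Finset.range H, M.γ ^ t * M.expReward π i t θ := by
  have hint (t : ℕ) : Integrable (fun τ => M.γ ^ t * M.r i (τ t)) (M.trajLaw π θ) :=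
    (Integrable.of_bound (M.measurable_r_apply i t).aestronglyMeasurable 1
      (.of_forall fun τ => M.abs_r_le_one i _)).const_mul _
  rw [← (M.hasLaw_truncLaw π θ H).integral_comp (M.measurable_trajValue i).aestronglyMeasurable]
  simp only [Function.comp_def, trajValue_restrict]
  rw [integral_finsetSum _ fun t _ => hint t]
  exact Finset.sum_congr rfl fun t _ => integral_const_mul _ _

lemma abs_expReward_le_one (i : Fin (m + 1)) (t : ℕ) : |M.expReward π i t θ| ≤ 1 := by
  have hle := norm_integral_le_of_norm_le_const (μ := M.trajLaw π θ)
    (f := fun τ => M.r i (τ t)) (.of_forall fun τ => M.abs_r_le_one i (τ t))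
  rwa [probReal_univ, mul_one] at hle

lemma abs_value_sub_integral_trajValue_le (i : Fin (m + 1)) :
    |M.value π i θ - ∫ x, M.trajValue i x ∂M.truncLaw π θ H| ≤ biasValue M.γ H := by
  have hγ := M.γ_pos.le
  have hgeom := (hasSum_geometric_of_lt_one hγ M.γ_lt_one).mul_left (M.γ ^ H)
  rw [M.integral_trajValue π θ i, biasValue, div_eq_mul_inv]
  refine norm_sub_sum_range_le (M.hasSum_expReward π i θ) hgeom fun k => ?_
  rw [norm_mul, Real.norm_of_nonneg (by positivity), pow_add, mul_comm (M.γ ^ H)]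
  exact mul_le_of_le_one_right (by positivity) (M.abs_expReward_le_one π θ i _)

end Law

variable {π} {U : Set (EuclideanSpace ℝ (Fin d))} {Mg Mh : ℝ} {θ : EuclideanSpace ℝ (Fin d)}
  (hπ : π.BoundedScore U Mg Mh)
include hπ

lemma measurable_trajGrad (hθ : θ ∈ U) (i : Fin (m + 1)) :
    Measurable (M.trajGrad π i θ (H := H)) :=
  Finset.measurable_fun_sum _ fun t _ => Finset.measurable_fun_sum _ fun t' _ =>
    (((M.measurable_r i).comp (measurable_pi_apply t)).const_mul _).smul
      ((hπ.measurable_score hθ).comp (measurable_pi_apply t'))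

variable [SFinite ν]

lemma integrable_trajGrad (hθ : θ ∈ U) (i : Fin (m + 1)) :
    Integrable (M.trajGrad π i θ) (M.truncLaw π θ H) := by
  refine (integrable_map_measure (M.measurable_trajGrad hπ hθ i).aestronglyMeasurable
    (M.hasLaw_truncLaw π θ H).aemeasurable).2 ?_
  simp only [Function.comp_def, trajGrad_restrict]
  exact integrable_finsetSum _ fun t _ => (M.integrable_rewardScore hπ hθ i t).fun_smul _

lemma integral_trajGrad (hθ : θ ∈ U) (i : Fin (m + 1)) :
    ∫ x, M.trajGrad π i θ x ∂M.truncLaw π θ H =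
      ∑ t ∈ Finset.range H, M.γ ^ t • M.expRewardGrad π i t θ := by
  have hint (t : ℕ) :
      Integrable (fun τ => M.γ ^ t • M.rewardScore π i t θ τ) (M.trajLaw π θ) :=
    (M.integrable_rewardScore hπ hθ i t).fun_smul _
  rw [← (M.hasLaw_truncLaw π θ H).integral_comp
    (M.measurable_trajGrad hπ hθ i).aestronglyMeasurable]
  simp only [Function.comp_def, trajGrad_restrict]
  rw [integral_finsetSum _ fun t _ => hint t]
  exact Finset.sum_congr rfl fun t _ => integral_smul _ _

variable (hU : IsOpen U)
include hU

lemma norm_gradient_value_sub_integral_trajGrad_le (hθ : θ ∈ U) (i : Fin (m + 1)) :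
    ‖gradient (M.value π i) θ - ∫ x, M.trajGrad π i θ x ∂M.truncLaw π θ H‖ ≤
      biasGrad M.γ Mg H := by
  have hγ := M.γ_pos
  have hMg := M.scoreBound_nonneg hπ hθ
  obtain ⟨b, hb, hsum⟩ :=
    exists_hasSum_geometric_mul_sqrt_le hγ.le M.γ_lt_one (Nat.cast_nonneg (α := ℝ) H)
  rw [(M.hasGradientAt_value hπ hU hθ i).gradient, M.integral_trajGrad hπ hθ i]
  refine (norm_sub_sum_range_le (M.hasSum_valueGrad hπ hU hθ i)
    (hsum.mul_left (Mg * M.γ ^ H)) fun k => ?_).trans ?_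
  · refine (M.norm_pow_smul_expRewardGrad_le hπ hU hθ i (k + H)).trans_eq ?_
    rw [pow_add, Nat.cast_add, add_right_comm]
    ring
  · calc Mg * M.γ ^ H * b ≤ Mg * M.γ ^ H * (√(1 / (1 - M.γ) + H) / (1 - M.γ)) := by gcongr
      _ = biasGrad M.γ Mg H := mul_div_left_comm _ _ _ |>.trans (mul_comm _ _)

lemma hasSubgaussianNorm_scoreSum (hθ : θ ∈ U) (t : ℕ) :
    HasSubgaussianNorm (π.scoreSum θ t) (Mg * √(t + 1)) (M.trajLaw π θ) := by
  refine ⟨(hπ.measurable_scoreSum hθ t).aestronglyMeasurable, fun c => ?_, fun c => ?_⟩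
  · refine .of_bound (Real.measurable_cosh.comp
      ((hπ.measurable_scoreSum hθ t).norm.const_mul c)).aestronglyMeasurable
      (Real.cosh (c * ((t + 1) * Mg))) (.of_forall fun τ => ?_)
    rw [Real.norm_of_nonneg (Real.cosh_pos _).le, Real.cosh_le_cosh, abs_mul, abs_mul, abs_norm]
    gcongr
    exact (hπ.norm_scoreSum_le hθ t τ).trans (le_abs_self _)
  · calc ∫ τ, Real.cosh (c * ‖π.scoreSum θ t τ‖) ∂M.trajLaw π θ
        ≤ Real.cosh (c * Mg) ^ (t + 1) := M.integral_cosh_mul_norm_scoreSum_le hπ hU hθ c t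
      _ ≤ Real.exp ((c * Mg) ^ 2 / 2) ^ (t + 1) :=
          pow_le_pow_left₀ (Real.cosh_pos _).le (Real.cosh_le_exp_half_sq _) _
      _ = Real.exp ((c * (Mg * √(t + 1))) ^ 2 / 2) := by
          rw [← Real.exp_nat_mul, ← mul_assoc, mul_pow _ √_, Real.sq_sqrt (by positivity)]
          push_cast
          ring_nf

lemma hasSubgaussianNorm_rewardScore (hθ : θ ∈ U) (i : Fin (m + 1)) (t : ℕ) :
    HasSubgaussianNorm (M.rewardScore π i t θ) (Mg * √(t + 1)) (M.trajLaw π θ) :=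
  (M.hasSubgaussianNorm_scoreSum hπ hU hθ t).of_norm_le
    (M.measurable_rewardScore hπ hθ i t).aestronglyMeasurable fun τ => by
      rw [rewardScore, norm_smul]
      exact mul_le_of_le_one_left (norm_nonneg _) (M.abs_r_le_one i _)

lemma hasSubgaussianNorm_trajGrad (hθ : θ ∈ U) (hMg : 0 < Mg) (i : Fin (m + 1)) :
    HasSubgaussianNorm (M.trajGrad π i θ) (Mg / (1 - M.γ) ^ (3 / 2 : ℝ))
      (M.truncLaw π θ H) := by
  have hγ := M.γ_pos
  have hsum : HasSubgaussianNorm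
      (fun τ => ∑ t ∈ Finset.range H, M.γ ^ t • M.rewardScore π i t θ τ)
      (∑ t ∈ Finset.range H, M.γ ^ t * (Mg * √(t + 1))) (M.trajLaw π θ) :=
    .finset_sum (fun t _ => (M.hasSubgaussianNorm_rewardScore hπ hU hθ i t).const_smul _)
      fun t _ => by positivity
  have hscale : ∑ t ∈ Finset.range H, M.γ ^ t * (Mg * √(t + 1)) ≤
      Mg / (1 - M.γ) ^ (3 / 2 : ℝ) := by
    simp_rw [mul_left_comm _ Mg]
    rw [← Finset.mul_sum, ← mul_one_div]
    exact mul_le_mul_of_nonneg_left (sum_range_geometric_mul_sqrt_le hγ.le M.γ_lt_one H) hMg.le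
  refine (HasSubgaussianNorm.comp_hasLaw_iff (M.hasLaw_truncLaw π θ H)
    (M.measurable_trajGrad hπ hθ i).aestronglyMeasurable).1 ?_
  simp only [Function.comp_def, trajGrad_restrict]
  exact hsum.mono (abs_le_abs_of_nonneg (Finset.sum_nonneg fun t _ => by positivity) hscale)

end CMDP

end Estimators

section Tails

variable {S A : Type*} [MeasurableSpace S] [MeasurableSpace A] {m d : ℕ} {ν : Measure A}
  [SFinite ν]

namespace CMDP

variable (M : CMDP S A m) {π : PolicyFamily S A d ν} {θ : EuclideanSpace ℝ (Fin d)} {n H : ℕ}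
  {Ω : Type*} [MeasurableSpace Ω] {Pr : Measure Ω} {τ : Fin n → Ω → Fin H → S × A}

lemma integrable_valueEst (i : Fin (m + 1)) (hτ : ∀ j, HasLaw (τ j) (M.truncLaw π θ H) Pr) :
    Integrable (fun ω => M.valueEst i fun j => τ j ω) Pr := by
  simp only [valueEst_eq_sampleMean]
  exact integrable_sampleMean (M.integrable_trajValue π θ i) hτ

lemma integral_valueEst (i : Fin (m + 1)) (hn : 0 < n)
    (hτ : ∀ j, HasLaw (τ j) (M.truncLaw π θ H) Pr) :
    ∫ ω, M.valueEst i (fun j => τ j ω) ∂Pr = ∫ x, M.trajValue i x ∂M.truncLaw π θ H := by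
  have : Nonempty (Fin n) := Fin.pos_iff_nonempty.1 hn
  simp only [valueEst_eq_sampleMean]
  exact integral_sampleMean (M.integrable_trajValue π θ i) hτ

lemma one_sub_le_measureReal_valueEst [IsProbabilityMeasure Pr] (i : Fin (m + 1)) (hn : 0 < n)
    (hind : iIndepFun τ Pr) (hτ : ∀ j, HasLaw (τ j) (M.truncLaw π θ H) Pr) {δ : ℝ} (hδ : 0 < δ)
    (hδ2 : δ ≤ 2) :
    1 - δ ≤ Pr.real {ω | |M.valueEst i (fun j => τ j ω)
        - ∫ ω', M.valueEst i (fun j => τ j ω') ∂Pr| ≤ scaleValue M.γ n * √(Real.log (2 / δ))} := by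
  have : Nonempty (Fin n) := Fin.pos_iff_nonempty.1 hn
  have hγ := sub_pos.2 M.γ_lt_one
  obtain ⟨B, hB⟩ : ∃ B : NNReal, (B : ℝ) = 1 / (1 - M.γ) := ⟨⟨_, by positivity⟩, rfl⟩
  have hB₀ : 0 < B := NNReal.coe_pos.1 (hB ▸ by positivity)
  have hsub := hasSubgaussianMGF_sampleMean_sub_integral (M.measurable_trajValue i)
    (fun x => (M.abs_trajValue_le i x).trans_eq hB.symm) hind hτ
  have hscale : √(2 * ↑(B ^ 2 / (n : NNReal)) * Real.log (2 / δ)) =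
      scaleValue M.γ n * √(Real.log (2 / δ)) := by
    push_cast
    rw [Real.sqrt_mul (by positivity), hB, mul_div_assoc', Real.sqrt_div (by positivity),
      Real.sqrt_mul zero_le_two, Real.sqrt_sq (by positivity), scaleValue, mul_one_div, div_div,
      mul_comm (1 - M.γ)]
  rw [Fintype.card_fin] at hsub
  rw [M.integral_valueEst i hn hτ, ← hscale]
  simp only [valueEst_eq_sampleMean]
  exact one_sub_le_measureReal_abs_le_of_hasSubgaussianMGF hsub (by positivity) hδ hδ2

variable {U : Set (EuclideanSpace ℝ (Fin d))} {Mg Mh : ℝ}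
  (hπ : π.BoundedScore U Mg Mh) (hθ : θ ∈ U)
include hπ hθ

lemma integrable_gradEst (i : Fin (m + 1)) (hτ : ∀ j, HasLaw (τ j) (M.truncLaw π θ H) Pr) :
    Integrable (fun ω => M.gradEst π i θ fun j => τ j ω) Pr := by
  simp only [gradEst_eq_sampleMean]
  exact integrable_sampleMean (M.integrable_trajGrad hπ hθ i) hτ

lemma integral_gradEst (i : Fin (m + 1)) (hn : 0 < n)
    (hτ : ∀ j, HasLaw (τ j) (M.truncLaw π θ H) Pr) :
    ∫ ω, M.gradEst π i θ (fun j => τ j ω) ∂Pr = ∫ x, M.trajGrad π i θ x ∂M.truncLaw π θ H := by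
  have : Nonempty (Fin n) := Fin.pos_iff_nonempty.1 hn
  simp only [gradEst_eq_sampleMean]
  exact integral_sampleMean (M.integrable_trajGrad hπ hθ i) hτ

lemma one_sub_le_measureReal_gradEst [IsProbabilityMeasure Pr] (hU : IsOpen U) (hMg : 0 < Mg)
    (i : Fin (m + 1)) (hn : 0 < n) (hind : iIndepFun τ Pr)
    (hτ : ∀ j, HasLaw (τ j) (M.truncLaw π θ H) Pr) {δ : ℝ} (hδ : 0 < δ) (hδ1 : δ ≤ 1)
    (hδn : 8 * Real.log (Real.exp (1 / 4) / δ) ≤ n) :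
    1 - δ ≤ Pr.real {ω | ‖M.gradEst π i θ (fun j => τ j ω)
        - ∫ ω', M.gradEst π i θ (fun j => τ j ω') ∂Pr‖
      ≤ scaleGrad M.γ Mg n * √(Real.log (Real.exp (1 / 4) / δ))} := by
  have : Nonempty (Fin n) := Fin.pos_iff_nonempty.1 hn
  have hγ := sub_pos.2 M.γ_lt_one
  have htail := one_sub_le_measureReal_norm_sampleMean_sub_integral_le
    (M.measurable_trajGrad hπ hθ i) (by positivity)
    (M.hasSubgaussianNorm_trajGrad hπ hU hθ hMg i) hind hτ hδ hδ1
    (by rwa [Fintype.card_fin])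
  have hscale : Mg / (1 - M.γ) ^ (3 / 2 : ℝ) * √(8 * Real.log (Real.exp (1 / 4) / δ) / n) =
      scaleGrad M.γ Mg n * √(Real.log (Real.exp (1 / 4) / δ)) := by
    have hsqrt : √8 = 2 * √2 := by
      rw [show (8 : ℝ) = 2 ^ 2 * 2 by norm_num, Real.sqrt_mul (by positivity),
        Real.sqrt_sq zero_le_two]
    rw [Real.sqrt_div' _ n.cast_nonneg, Real.sqrt_mul (by positivity), hsqrt, scaleGrad]
    field_simp
  rw [Fintype.card_fin, hscale] at htail
  rw [M.integral_gradEst hπ hθ i hn hτ]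
  simpa only [gradEst_eq_sampleMean] using htail

end CMDP

end Tails

theorem mainTheorem7 {S A : Type*} [MeasurableSpace S] [MeasurableSpace A] {m d : ℕ}
    {ν : Measure A} [SFinite ν] (M : CMDP S A m) (π : PolicyFamily S A d ν)
    (U : Set (EuclideanSpace ℝ (Fin d))) (hU : IsOpen U)
    (Mg Mh : ℝ) (hMg : 0 < Mg) (hMh : 0 < Mh) (hπ : π.BoundedScore U Mg Mh)
    (i : Fin (m + 1)) :
    -- Lipschitz continuity and smoothness of the value functions
    ((∀ θ ∈ U, DifferentiableAt ℝ (M.value π i) θ) ∧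
      ∀ X : Set (EuclideanSpace ℝ (Fin d)), convexHull ℝ X ⊆ U →
        LipschitzContOn (M.value π i) (Mg / (1 - M.γ) ^ 2) X ∧
        MSmoothOn (M.value π i) ((Mg ^ 2 + Mh) / (1 - M.γ) ^ 2) X) ∧
    -- the estimators, from `n` independent trajectories of horizon `H` sampled under `π_θ`
    ∀ θ ∈ U, ∀ (n H : ℕ), 0 < n →
      ∀ {Ω : Type*} [MeasurableSpace Ω] (Pr : Measure Ω) [IsProbabilityMeasure Pr]
        (τ : Fin n → Ω → (Fin H → S × A)),
        iIndepFun τ Pr → (∀ j, HasLaw (τ j) (M.truncLaw π θ H) Pr) →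
        -- bias bounds
        (Integrable (fun ω => M.valueEst i (fun j => τ j ω)) Pr ∧
          |M.value π i θ - ∫ ω, M.valueEst i (fun j => τ j ω) ∂Pr| ≤ biasValue M.γ H) ∧
        (Integrable (fun ω => M.gradEst π i θ (fun j => τ j ω)) Pr ∧
          ‖gradient (M.value π i) θ - ∫ ω, M.gradEst π i θ (fun j => τ j ω) ∂Pr‖
            ≤ biasGrad M.γ Mg H) ∧
        -- sub-Gaussian tail bounds
        ∀ δ : ℝ, 0 < δ → δ < 1 →
          1 - δ ≤ Pr.real {ω | |M.valueEst i (fun j => τ j ω)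
              - ∫ ω', M.valueEst i (fun j => τ j ω') ∂Pr|
            ≤ scaleValue M.γ n * √(Real.log (2 / δ))} ∧
          (8 * Real.log (Real.exp (1 / 4) / δ) ≤ n →
            1 - δ ≤ Pr.real {ω | ‖M.gradEst π i θ (fun j => τ j ω)
                - ∫ ω', M.gradEst π i θ (fun j => τ j ω') ∂Pr‖
              ≤ scaleGrad M.γ Mg n * √(Real.log (Real.exp (1 / 4) / δ))})
    := by
  refine ⟨⟨fun θ hθ => (M.hasGradientAt_value hπ hU hθ i).differentiableAt,
    fun X hX => ⟨M.lipschitzContOn_value hπ hU i hX, M.mSmoothOn_value hπ hU i hX⟩⟩, ?_⟩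
  intro θ hθ n H hn Ω _ Pr _ τ hind hτ
  refine ⟨⟨M.integrable_valueEst i hτ, ?_⟩, ⟨M.integrable_gradEst hπ hθ i hτ, ?_⟩,
    fun δ hδ hδ1 => ⟨M.one_sub_le_measureReal_valueEst i hn hind hτ hδ (by linarith),
      M.one_sub_le_measureReal_gradEst hπ hθ hU hMg i hn hind hτ hδ hδ1.le⟩⟩
  · rw [M.integral_valueEst i hn hτ]
    exact M.abs_value_sub_integral_trajValue_le π θ i
  · rw [M.integral_gradEst hπ hθ i hn hτ]
    exact M.norm_gradient_value_sub_integral_trajGrad_le hπ hU hθ i
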